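/- Let $\mathfrak B$ be a real or complex Banach space, let $A$ be the infinitesimal generator of a $C_0$-semigroup $\{U(t)\}_{t\ge 0}$ on $\mathfrak B$, and suppose that this semigroup is hyperbolic with projection $\mathcal P$ and constants $\mathcal N,\nu>0$: $\mathcal P$ is a bounded projection commuting with every $U(t)$, and with $\mathcal Q:=I-\mathcal P$ each $U(t)$ maps $\operatorname{Im}\mathcal Q$ bijectively onto itself, $|U(t)\mathcal P x|\le \mathcal N e^{-\nu t}|x|$ for $t\ge 0$, and $|U_{\mathcal Q}(t)\mathcal Q x|\le \mathcal N e^{\nu t}|x|$ for $t<0$ (all $x\in\mathfrak B$), where $U_{\mathcal Q}(t):=(U(-t)|_{\operatorname{Im}\mathcal Q})^{-1}$ for $t<0$. All spaces of continuous functions carry the compact-open topology. Let $f\in C(\mathbb R_+,\mathfrak B)$ and $F\in C(\mathbb R_+\times\mathfrak B,\mathfrak B)$ be Lagrange stable, i.e. the sets of time translates $\{f(h+\cdot):h\ge 0\}$ and $\{F(h+\cdot,\cdot):h\ge 0\}$ are pre-compact in $C(\mathbb R_+,\mathfrak B)$ and $C(\mathbb R_+\times\mathfrak B,\mathfrak B)$,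 and let $|F(t,x)-F(t,y)|\le L|x-y|$ for all $t\ge 0$, $x,y\in\mathfrak B$, with a constant $0\le L<\frac{\nu}{2\mathcal N}$. Then the equation $u'=Au+f(t)+F(t,u)$ has exactly one Lagrange stable mild solution $\varphi\in C(\mathbb R_+,\mathfrak B)$ (that is, $\varphi(t)=U(t)\varphi(0)+\int_0^tU(t-s)\,[f(s)+F(s,\varphi(s))]\,ds$ for all $t\ge0$) with $\mathcal P\varphi(0)=0$. Put $Q:=\overline{\varphi(\mathbb R_+)}$, which is compact, and $F_Q:=F|_{\mathbb R_+\times Q}$. If $f$ and $F_Q$ are jointly asymptotically stationary (respectively, asymptotically $\tau$-periodic, asymptotically quasi-periodic with the spectrum of frequencies $\nu_1,\dots,\nu_k$, asymptotically Bohr almost periodic, asymptotically Bohr almost automorphic, asymptotically Birkhoff recurrent), i.e. if $t\mapsto (f(t),F(t,\cdot)|_Q)\in\mathfrak B\times C(Q,\mathfrak B)$ has this property, then $\varphi$ has the same property (with the same $\tau$, respectively the same $\nu_1,\dots,\nu_k$). Here $g\in C(\mathbb R_+,X)$, with $(X,\rho)$ a complete metric space, is asymptotically of a given class if there is a function $p$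 of that class with $\rho(g(t),p(t))\to 0$ as $t\to+\infty$; $p\in C(\mathbb R_+,X)$ for all classes except the almost automorphic one, for which $p\in C(\mathbb R,X)$. For $\mathbb T=\mathbb R_+$ or $\mathbb R$ and $p\in C(\mathbb T,X)$, a set $S\subseteq\mathbb T$ is relatively dense if for some $l>0$ it meets $[a,a+l]$ for every $a\in\mathbb T$; $\tau\in\mathbb T$ is an $\varepsilon$-almost period of $p$ if $\rho(p(t+\tau),p(t))<\varepsilon$ for all $t\in\mathbb T$. The function $p$ is: stationary if it is constant; $\tau$-periodic if $p(t+\tau)=p(t)$ for all $t$; quasi-periodic with the spectrum of frequencies $\nu_1,\dots,\nu_k\in\mathbb R$ if these are rationally independent and $p(t)=\Phi(\nu_1t,\dots,\nu_kt)$ for a continuous $\Phi:\mathbb R^k\to X$ that is $2\pi$-periodic in each variable; Bohr almost periodic if for each $\varepsilon>0$ its $\varepsilon$-almost periods are relatively dense; Lagrange stable if its translates $p^h:=p(h+\cdot)$, $h\in\mathbb T$, form a pre-compact set in $C(\mathbb T,X)$; Birkhoff recurrent if it is Lagrange stable and for each neighbourhood $V$ of $p$ in $C(\mathbb T,X)$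 the set $\{\tau:p^\tau\in V\}$ is relatively dense; Levitan almost periodic if there is a Bohr almost periodic function $\psi\in C(\mathbb T,Y)$, $Y$ a complete metric space, such that for each neighbourhood $V$ of $p$ in $C(\mathbb T,X)$ there is $\delta>0$ with $p^\tau\in V$ for every $\delta$-almost period $\tau$ of $\psi$; (Bohr) almost automorphic, for $\mathbb T=\mathbb R$, if it is Levitan almost periodic and Lagrange stable. -/

import Mathlib

open Set Filter Topology TopologicalSpace
open scoped NNReal

universe u v w

/-! The time set `T` below is `ℝ` or `ℝ≥0 = [0, ∞)`; `C(T, X)` carries the compact-open topology. -/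

section Functions

variable {T : Type v} [AddCommMonoid T] [LinearOrder T] [TopologicalSpace T] [ContinuousAdd T]
variable {X : Type u} {Y : Type w}

/-- The translate `φ^h`, `φ^h(t) = φ(h + t)`. -/
def timeShift [TopologicalSpace X] (h : T) (φ : C(T, X)) : C(T, X) where
  toFun t := φ (h + t)
  continuous_toFun := by fun_prop

/-- The translate in time `F^h`, `F^h(t, x) = F(h + t, x)`. -/
def timeShiftParam [TopologicalSpace X] [TopologicalSpace Y] (h : T) (F : C(T × Y, X)) :
    C(T × Y, X) where
  toFun z := F (h + z.1, z.2)
  continuous_toFun := by fun_prop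

/-- `φ` is Lagrange stable: its translates form a pre-compact subset of `C(T, X)`. -/
def IsLagrangeStable [TopologicalSpace X] (φ : C(T, X)) : Prop :=
  IsCompact (closure (Set.range fun h : T => timeShift h φ))

/-- `F` is Lagrange stable: its time translates form a pre-compact subset of `C(T × Y, X)`. -/
def IsLagrangeStableParam [TopologicalSpace X] [TopologicalSpace Y] (F : C(T × Y, X)) : Prop :=
  IsCompact (closure (Set.range fun h : T => timeShiftParam h F))

/-- A subset of `T` is relatively dense if it meets every interval `[a, a + l]`, for some `l > 0`. -/
def IsRelativelyDense (S : Set T) : Prop :=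
  ∃ l : T, 0 < l ∧ ∀ a : T, (S ∩ Set.Icc a (a + l)).Nonempty

/-- `φ` is stationary (constant). -/
def IsTimeStationary [TopologicalSpace X] (φ : C(T, X)) : Prop :=
  ∀ t : T, φ t = φ 0

/-- `φ` is `τ`-periodic. -/
def IsTimePeriodic [TopologicalSpace X] (τ : T) (φ : C(T, X)) : Prop :=
  ∀ t : T, φ (t + τ) = φ t

/-- The set of `ε`-almost periods of `φ`. -/
def almostPeriods [MetricSpace X] (φ : C(T, X)) (ε : ℝ) : Set T :=
  {τ | ∀ t : T, dist (φ (t + τ)) (φ t) < ε}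

/-- `φ` is Bohr almost periodic. -/
def IsBohrAlmostPeriodic [MetricSpace X] (φ : C(T, X)) : Prop :=
  ∀ ε : ℝ, 0 < ε → IsRelativelyDense (almostPeriods φ ε)

/-- `φ` is almost recurrent: for each neighbourhood of `φ` in `C(T, X)` (equivalently, each ball
around `φ` for a metric inducing the compact-open topology), the times at which the translates
of `φ` lie in it form a relatively dense set. -/
def IsAlmostRecurrent [TopologicalSpace X] (φ : C(T, X)) : Prop :=
  ∀ V ∈ 𝓝 φ, IsRelativelyDense {τ : T | timeShift τ φ ∈ V}

/-- `φ` is (Birkhoff) recurrent: almost recurrent and Lagrange stable. -/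
def IsBirkhoffRecurrent [TopologicalSpace X] (φ : C(T, X)) : Prop :=
  IsAlmostRecurrent φ ∧ IsLagrangeStable φ

/-- `φ` is Levitan almost periodic: for some Bohr almost periodic `ψ` with values in a complete
metric space, the translates of `φ` by `δ`-almost periods of `ψ` are as close to `φ` in `C(T, X)`
as desired when `δ` is small enough. -/
def IsLevitanAlmostPeriodic [MetricSpace X] (φ : C(T, X)) : Prop :=
  ∃ (Z : Type u) (_ : MetricSpace Z) (_ : CompleteSpace Z) (ψ : C(T, Z)),
    IsBohrAlmostPeriodic ψ ∧
      ∀ V ∈ 𝓝 φ, ∃ δ : ℝ, 0 < δ ∧ ∀ τ ∈ almostPeriods ψ δ, timeShift τ φ ∈ V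

end Functions

section Classes

variable {X : Type u}

/-- A function on the whole line is (Bohr) almost automorphic if it is Levitan almost periodic and
Lagrange stable. -/
def IsAlmostAutomorphic [MetricSpace X] (φ : C(ℝ, X)) : Prop :=
  IsLevitanAlmostPeriodic φ ∧ IsLagrangeStable φ

/-- `φ` is quasi-periodic with the spectrum of frequencies `ν₁, …, ν_k`: these are rationally
independent and `φ(t) = Φ(ν₁ t, …, ν_k t)` with `Φ` continuous and `2π`-periodic in each of its
variables. -/
def IsQuasiPeriodic [TopologicalSpace X] {k : ℕ} (ν : Fin k → ℝ) (φ : C(ℝ≥0, X)) : Prop :=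
  LinearIndependent ℚ ν ∧
    ∃ Φ : C(Fin k → ℝ, X),
      (∀ (θ : Fin k → ℝ) (i : Fin k), Φ (Function.update θ i (θ i + 2 * Real.pi)) = Φ θ) ∧
      ∀ t : ℝ≥0, φ t = Φ fun i => ν i * t

/-- `φ` is asymptotically in the class `K` of functions on the half-line. -/
def IsAsymptotically [MetricSpace X] (K : C(ℝ≥0, X) → Prop) (φ : C(ℝ≥0, X)) : Prop :=
  ∃ p : C(ℝ≥0, X), K p ∧ Tendsto (fun t : ℝ≥0 => dist (φ t) (p t)) atTop (𝓝 0)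

/-- `φ` is asymptotically almost automorphic; almost automorphic functions live on the whole
line. -/
def IsAsymptoticallyAlmostAutomorphic [MetricSpace X] (φ : C(ℝ≥0, X)) : Prop :=
  ∃ p : C(ℝ, X), IsAlmostAutomorphic p ∧
    Tendsto (fun t : ℝ≥0 => dist (φ t) (p (t : ℝ))) atTop (𝓝 0)

/-- The closure of the range of a Lagrange stable function is compact. -/
theorem IsLagrangeStable.isCompact_closure_range [MetricSpace X] {φ : C(ℝ≥0, X)}
    (h : IsLagrangeStable φ) : IsCompact (closure (Set.range φ)) := by
  have hev : Continuous fun ψ : C(ℝ≥0, X) => ψ 0 := by fun_prop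
  refine (h.image hev).closure_of_subset ?_
  rintro _ ⟨t, rfl⟩
  exact ⟨timeShift t φ, subset_closure ⟨t, rfl⟩, by simp [timeShift]⟩

/-- The compact set `Q`, the closure of `φ(ℝ₊)`, for a Lagrange stable function `φ`. -/
def IsLagrangeStable.rangeClosure [MetricSpace X] {φ : C(ℝ≥0, X)}
    (h : IsLagrangeStable φ) : Compacts X :=
  ⟨closure (Set.range φ), h.isCompact_closure_range⟩

end Classes

section Equation

variable {𝕜 : Type v} {B : Type u} [RCLike 𝕜] [NormedAddCommGroup B] [NormedSpace 𝕜 B]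

/-- The pair `(f, F_Q)`, `F_Q` being the restriction of `F` to `ℝ₊ × Q`, as one function
`t ↦ (f(t), F(t, ·)|_Q)` with values in `B × C(Q, B)`, where `C(Q, B)` has the maximum metric. -/
def jointCoefficients (f : C(ℝ≥0, B)) (F : C(ℝ≥0 × B, B)) (Q : Compacts B) :
    C(ℝ≥0, B × C(Q, B)) :=
  f.prodMk (ContinuousMap.curry
    (F.comp ((ContinuousMap.id ℝ≥0).prodMap ⟨((↑) : Q → B), continuous_subtype_val⟩)))

/-- `U` is a `C₀`-semigroup of bounded operators. -/
structure IsC0Semigroup (U : ℝ≥0 → B →L[𝕜] B) : Prop where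
  map_zero : U 0 = ContinuousLinearMap.id 𝕜 B
  map_add : ∀ s t : ℝ≥0, U (s + t) = (U s).comp (U t)
  continuous_orbit : ∀ x : B, Continuous fun t : ℝ≥0 => U t x

/-- The partially defined operator `A` is the infinitesimal generator of `U`: `x` lies in its
domain with `A x = y` iff `(U(h) x - x) / h → y` as `h → 0+`. -/
def IsInfinitesimalGenerator [NormedSpace ℝ B] (A : B →ₗ.[𝕜] B) (U : ℝ≥0 → B →L[𝕜] B) : Prop :=
  ∀ x y : B, (x, y) ∈ A.graph ↔
    Tendsto (fun h : ℝ≥0 => (h : ℝ)⁻¹ • (U h x - x)) (𝓝[>] 0) (𝓝 y)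

/-- `U` is hyperbolic with projection `P` and constants `N, ν`. Below `id - P` is the complementary
projection `Q`; the element `y` of `Im Q` with `U(t) y = Q x` is `U_Q(-t) x`, where
`U_Q(-t) = [U(t) Q]⁻¹` is the inverse of `U(t)` on `Im Q`, applied to the component `Q x` of `x`. -/
structure IsHyperbolicSemigroup (U : ℝ≥0 → B →L[𝕜] B) (P : B →L[𝕜] B) (N ν : ℝ) : Prop where
  N_pos : 0 < N
  ν_pos : 0 < ν
  proj : P.comp P = P
  comm : ∀ t : ℝ≥0, (U t).comp P = P.comp (U t)
  invertible : ∀ t : ℝ≥0, Set.BijOn (U t)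
    (Set.range (ContinuousLinearMap.id 𝕜 B - P)) (Set.range (ContinuousLinearMap.id 𝕜 B - P))
  stable : ∀ (t : ℝ≥0) (x : B), ‖U t (P x)‖ ≤ N * Real.exp (-ν * t) * ‖x‖
  unstable : ∀ (t : ℝ≥0), 0 < t → ∀ x y : B,
    y ∈ Set.range (ContinuousLinearMap.id 𝕜 B - P) →
      U t y = (ContinuousLinearMap.id 𝕜 B - P) x → ‖y‖ ≤ N * Real.exp (-ν * t) * ‖x‖

/-- `φ` is a mild solution on `ℝ₊` of `u' = A u + f(t) + F(t, u)`, `A` being the generator of `U`: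
`φ(t) = U(t) φ(0) + ∫₀ᵗ U(t - s) (f(s) + F(s, φ(s))) ds` for all `t ≥ 0`. -/
def IsMildSolution [NormedSpace ℝ B] (U : ℝ≥0 → B →L[𝕜] B) (f : C(ℝ≥0, B)) (F : C(ℝ≥0 × B, B))
    (φ : C(ℝ≥0, B)) : Prop :=
  ∀ t : ℝ≥0, φ t = U t (φ 0) + ∫ s in (0 : ℝ)..(t : ℝ),
    U (t - s.toNNReal) (f s.toNNReal + F (s.toNNReal, φ s.toNNReal))

end Equation

/-!
A hyperbolic semigroup `U` is an exponential dichotomy: besides the semigroup itself there is the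
strongly continuous family `V t` inverting `U t` on the range of `1 - P`, and both `U t P` and `V t`
decay like `N * exp (-ν * t)`. For a mild solution `x` with forcing `g`, the stable component at time
`t` is expressed through the state at `t - r` and the forcing on `[t - r, t]`, and the unstable one
through the state at `t + r` and the forcing on `[t, t + r]`. Hence (`IsMildFrom.norm_le`) a solution
bounded by `M` on `[a, ∞)`, with forcing bounded by `D`, is bounded on `[a + r, ∞)` by
`2 N exp (-ν r) M + (2 N / ν) D`, and by `(2 N / ν) D` on all of `[a, ∞)` if `P x(a) = 0`
(`IsMildFrom.norm_le_of_proj_eq_zero`).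

*Existence and uniqueness.* The linear equation whose forcing has values in a compact set has a
solution with `P x(0) = 0` and totally bounded range (`ExpDichotomy.exists_mild`); the range is
approximated by integrals over bounded intervals, which lie in multiples of a closed convex hull of a
compact set. The second bound makes the semilinear solution operator a contraction with constant
`2 N L / ν < 1` of the space of bounded functions with totally bounded range
(`ExpDichotomy.exists_semilinear`). A mild solution with totally bounded range is uniformly
continuous, hence Lagrange stable by the Arzelà–Ascoli theorem.

*Comparison.* Iterating the first bound with a fixed `r` shows that the difference of two bounded
solutions, whose coefficients differ by `ε` in `B × C(Q, B)`, is eventually bounded by a constant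
times `ε` up to a geometrically decaying error (`ExpDichotomy.exists_comparison`). So solutions of
asymptotically equal equations are asymptotically equal, and on the whole line solutions are unique.

*Asymptotic classes.* Let the coefficients `J` of the equation solved by `φ` be asymptotic to `p`, and
let `τ n → ∞` with `p (· + τ n) → p`. A limit `q` of the translates `φ (· + τ n)` solves the equation
with coefficients `p`, so `φ` is asymptotic to `q`; and comparing `φ (· + τ)` with `φ` shows that
`dist (q (t + τ)) (q t)` is at most a constant times `sup_s dist (p (s + τ)) (p s)`
(`IsSolutionFrom.exists_asymptotic`). This settles the stationary, periodic and Bohr almost periodic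
classes. In the quasi-periodic case it says that `q` is uniformly continuous in the position of the
flow on the torus, which is dense by Kronecker's theorem (`exists_dist_torusFlow_lt`, a consequence of
Weyl equidistribution), so `q` extends to the torus. In the Birkhoff recurrent case the past of `p` is
not determined by its future, so the choice of `q` matters: `(p, q)` is taken in a minimal subset of
the `ω`-limit set of `(J, φ)` (`IsBirkhoffRecurrent.exists_recurrent_limit`). In the almost
automorphic case `q` is a solution on the whole line, and its uniqueness transfers the Levitan
property from `p` to `q` with the same Bohr almost periodic function
(`IsSolutionFrom.asymptotically_almostAutomorphic`).
-/

/-! ### Exponential dichotomies -/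

/-- An exponential dichotomy in the form used below: `S` is a strongly continuous semigroup, `P` a
projection commuting with it, and `V t` is the inverse of `S t` on the range of `1 - P`, composed
with `1 - P`. Both families are indexed by `ℝ`, and only their values at `t ≥ 0` carry information;
all operators are real-linear, whatever the scalar field of the original semigroup. -/
structure ExpDichotomy {B : Type u} [NormedAddCommGroup B] [NormedSpace ℝ B]
    (S V : ℝ → B →L[ℝ] B) (P : B →L[ℝ] B) (N ν : ℝ) : Prop where
  N_pos : 0 < N
  ν_pos : 0 < ν
  S_zero : ∀ x, S 0 x = x
  S_add : ∀ s t : ℝ, 0 ≤ s → 0 ≤ t → ∀ x, S (s + t) x = S s (S t x)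
  S_cont : ∀ x, Continuous fun t => S t x
  V_cont : ∀ x, Continuous fun t => V t x
  proj : ∀ x, P (P x) = P x
  comm : ∀ t x, S t (P x) = P (S t x)
  P_V : ∀ t x, P (V t x) = 0
  V_P : ∀ t x, V t (P x) = 0
  S_V : ∀ t : ℝ, 0 ≤ t → ∀ x, S t (V t x) = x - P x
  V_S : ∀ t : ℝ, 0 ≤ t → ∀ x, V t (S t x) = x - P x
  V_add : ∀ s t : ℝ, 0 ≤ s → 0 ≤ t → ∀ x, V (s + t) x = V s (V t x)
  stable : ∀ t : ℝ, 0 ≤ t → ∀ x, ‖S t (P x)‖ ≤ N * Real.exp (-ν * t) * ‖x‖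
  unstable : ∀ t : ℝ, 0 ≤ t → ∀ x, ‖V t x‖ ≤ N * Real.exp (-ν * t) * ‖x‖

section Construction

variable {𝕜 : Type v} {B : Type u} [RCLike 𝕜] [NormedAddCommGroup B] [NormedSpace 𝕜 B]

theorem IsHyperbolicSemigroup.mem_range_compl {U : ℝ≥0 → B →L[𝕜] B} {P : B →L[𝕜] B} {N ν : ℝ}
    (h : IsHyperbolicSemigroup U P N ν) {y : B} :
    y ∈ Set.range (ContinuousLinearMap.id 𝕜 B - P) ↔ P y = 0 := by
  constructor
  · rintro ⟨x, rfl⟩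
    have := congrArg (fun T : B →L[𝕜] B => T x) h.proj
    simp only [ContinuousLinearMap.comp_apply] at this
    simp [this]
  · intro hy
    exact ⟨y, by simp [hy]⟩

theorem IsHyperbolicSemigroup.injective_on_ker {U : ℝ≥0 → B →L[𝕜] B} {P : B →L[𝕜] B} {N ν : ℝ}
    (h : IsHyperbolicSemigroup U P N ν) (t : ℝ≥0) {y z : B} (hy : P y = 0) (hz : P z = 0)
    (hyz : U t y = U t z) : y = z :=
  (h.invertible t).injOn (h.mem_range_compl.2 hy) (h.mem_range_compl.2 hz) hyz

variable [NormedSpace ℝ B]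

/-- A bounded `𝕜`-linear operator as a bounded real-linear operator. No compatibility between the
two scalar actions is needed, since a continuous additive map is real-linear. -/
noncomputable def ContinuousLinearMap.toRealOperator (T : B →L[𝕜] B) : B →L[ℝ] B :=
  AddMonoidHom.toRealLinearMap (T : B →+ B) T.continuous

@[simp] theorem ContinuousLinearMap.toRealOperator_apply (T : B →L[𝕜] B) (x : B) :
    T.toRealOperator x = T x := rfl

/-- A hyperbolic semigroup gives rise to an exponential dichotomy. -/
theorem IsHyperbolicSemigroup.exists_expDichotomy {U : ℝ≥0 → B →L[𝕜] B} {P : B →L[𝕜] B}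
    {N ν : ℝ} (hU : IsC0Semigroup U) (h : IsHyperbolicSemigroup U P N ν) :
    ∃ V : ℝ → B →L[ℝ] B,
      ExpDichotomy (fun t => (U t.toNNReal).toRealOperator) V P.toRealOperator N ν := by
  have hproj : ∀ x, P (P x) = P x := fun x =>
    congrArg (fun T : B →L[𝕜] B => T x) h.proj
  have hcomm : ∀ t x, U t (P x) = P (U t x) := fun t x =>
    congrArg (fun T : B →L[𝕜] B => T x) (h.comm t)
  have hadd : ∀ s t x, U (s + t) x = U s (U t x) := fun s t x =>
    congrArg (fun T : B →L[𝕜] B => T x) (hU.map_add s t)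
  have hzero : ∀ x, U 0 x = x := fun x => congrArg (fun T : B →L[𝕜] B => T x) hU.map_zero
  have hex : ∀ (t : ℝ≥0) (x : B), ∃ y, P y = 0 ∧ U t y = x - P x := by
    intro t x
    have hx : x - P x ∈ Set.range (ContinuousLinearMap.id 𝕜 B - P) := ⟨x, by simp⟩
    obtain ⟨y, hy, hyx⟩ := (h.invertible t).surjOn hx
    exact ⟨y, h.mem_range_compl.1 hy, hyx⟩
  choose W hPW hUW using hex
  have huniq : ∀ t x y, P y = 0 → U t y = x - P x → y = W t x := fun t x y hy hyx =>
    h.injective_on_ker t hy (hPW t x) (by rw [hyx, hUW])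
  have hbd0 : ∀ t : ℝ≥0, 0 < t → ∀ x, ‖W t x‖ ≤ N * Real.exp (-ν * t) * ‖x‖ := fun t ht x =>
    h.unstable t ht x (W t x) (h.mem_range_compl.2 (hPW t x)) (by simp [hUW])
  have hWU : ∀ t x, W t (U t x) = x - P x := fun t x =>
    (huniq t _ _ (by simp [hproj]) (by simp [hcomm])).symm
  have hWP : ∀ t x, W t (P x) = 0 := fun t x =>
    (huniq t _ _ (by simp) (by simp [hproj])).symm
  have hWadd : ∀ s t x, W (s + t) x = W s (W t x) := by
    intro s t x
    refine (huniq _ _ _ (hPW _ _) ?_).symm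
    rw [add_comm, hadd, hUW, map_sub, hUW, hPW]; simp
  have hWsub : ∀ t x y, W t (x - y) = W t x - W t y := by
    intro t x y
    refine (huniq _ _ _ (by simp [hPW]) ?_).symm
    simp only [map_sub, hUW]; abel
  -- increments of `W` are `W` applied to increments of orbits of `U`
  have hincr : ∀ s t : ℝ≥0, ∀ x, W (s + t) x - W s x = W (s + t) (x - U t x) := by
    intro s t x
    have h1 : W (s + t) (U t x) = W s x := by
      rw [hWadd, hWU, hWsub, hWP, sub_zero]
    rw [hWsub, h1]
  have hcont : ∀ x, Continuous fun t => W t x := by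
    intro x
    rw [continuous_iff_continuousAt]
    intro t₀
    rw [ContinuousAt, tendsto_iff_dist_tendsto_zero]
    have hlim : Tendsto (fun t : ℝ≥0 => N * ‖x - U ((t - t₀) + (t₀ - t)) x‖) (𝓝 t₀) (𝓝 0) := by
      have hc : Continuous fun t : ℝ≥0 => N * ‖x - U ((t - t₀) + (t₀ - t)) x‖ := by
        have h1 : Continuous fun t : ℝ≥0 => (t - t₀) + (t₀ - t) := by fun_prop
        have := (hU.continuous_orbit x).comp h1
        exact continuous_const.mul (continuous_const.sub this).norm
      have := hc.tendsto t₀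
      simpa [hzero] using this
    refine squeeze_zero (fun _ => dist_nonneg) ?_ hlim
    have hle : ∀ t : ℝ≥0, 0 < t → ∀ y, ‖W t y‖ ≤ N * ‖y‖ := by
      intro t ht y
      refine (hbd0 t ht y).trans ?_
      have : Real.exp (-ν * t) ≤ 1 := Real.exp_le_one_iff.2 (by
        have := h.ν_pos; have : 0 ≤ ν * (t : ℝ) := by positivity
        linarith)
      have hN := h.N_pos
      have : N * Real.exp (-ν * t) ≤ N * 1 := by gcongr
      nlinarith [norm_nonneg y]
    intro t
    rcases lt_trichotomy t t₀ with hlt | rfl | hlt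
    · have h2 : t + (t₀ - t) = t₀ := add_tsub_cancel_of_le hlt.le
      have h3 := hincr t (t₀ - t) x
      rw [h2] at h3
      rw [dist_comm, dist_eq_norm, h3, tsub_eq_zero_of_le hlt.le, zero_add]
      exact hle t₀ (pos_of_gt hlt) _
    · have := h.N_pos
      simp only [dist_self]; positivity
    · have h2 : t₀ + (t - t₀) = t := add_tsub_cancel_of_le hlt.le
      have h3 := hincr t₀ (t - t₀) x
      rw [h2] at h3
      rw [dist_eq_norm, h3, tsub_eq_zero_of_le hlt.le, add_zero]
      exact hle t (pos_of_gt hlt) _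
  have hbd : ∀ t : ℝ≥0, ∀ x, ‖W t x‖ ≤ N * Real.exp (-ν * t) * ‖x‖ := by
    intro t x
    rcases eq_zero_or_pos t with rfl | ht
    · -- the estimate at `t = 0` is the limit of those at `t > 0`
      have hl : Tendsto (fun t : ℝ≥0 => ‖W t x‖) (𝓝[>] 0) (𝓝 ‖W 0 x‖) :=
        ((hcont x).norm.tendsto 0).mono_left nhdsWithin_le_nhds
      have hr : Tendsto (fun t : ℝ≥0 => N * Real.exp (-ν * t) * ‖x‖) (𝓝[>] 0)
          (𝓝 (N * Real.exp (-ν * (0 : ℝ≥0)) * ‖x‖)) := by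
        have : Continuous fun t : ℝ≥0 => N * Real.exp (-ν * t) * ‖x‖ := by fun_prop
        exact (this.tendsto 0).mono_left nhdsWithin_le_nhds
      exact le_of_tendsto_of_tendsto hl hr
        (eventually_nhdsWithin_of_forall fun t ht => hbd0 t ht x)
    · exact hbd0 t ht x
  let Wh : ℝ≥0 → B →+ B := fun t => AddMonoidHom.ofMapSub (W t) (hWsub t)
  have hWc : ∀ t, Continuous (Wh t) := fun t =>
    AddMonoidHomClass.continuous_of_bound (Wh t) _ (hbd t)
  refine ⟨fun t => (Wh t.toNNReal).toRealLinearMap (hWc _), h.N_pos, h.ν_pos, ?_, ?_, ?_, ?_,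
    hproj, fun t => hcomm _, fun t x => hPW _ _, fun t x => hWP _ _, fun t _ x => hUW _ _,
    fun t _ x => hWU _ _, ?_, ?_, ?_⟩
  · intro x; simp [hzero]
  · intro s t hs ht x
    simp [Real.toNNReal_add hs ht, hadd]
  · exact fun x => (hU.continuous_orbit x).comp continuous_real_toNNReal
  · exact fun x => (hcont x).comp continuous_real_toNNReal
  · intro s t hs ht x
    change W (s + t).toNNReal x = W _ (W _ x)
    rw [Real.toNNReal_add hs ht, hWadd]
  · intro t ht x
    simpa [ht] using h.stable t.toNNReal x
  · intro t ht x
    have := hbd t.toNNReal x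
    rwa [Real.coe_toNNReal t ht] at this

end Construction

/-! ### Mild solutions and their a priori bounds -/

section Mild

variable {B : Type u} [NormedAddCommGroup B] [NormedSpace ℝ B]

/-- The norms of a strongly continuous family of bounded operators are locally bounded, by the
uniform boundedness principle. -/
theorem exists_norm_le_of_strongly_continuous [CompleteSpace B] {W : ℝ → B →L[ℝ] B}
    (hW : ∀ x, Continuous fun t => W t x) (a b : ℝ) :
    ∃ C, ∀ t ∈ Set.Icc a b, ‖W t‖ ≤ C := by
  obtain ⟨C, hC⟩ : ∃ C, ∀ t : Set.Icc a b, ‖W t‖ ≤ C := by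
    refine banach_steinhaus fun x => ?_
    obtain ⟨C, hC⟩ := (isCompact_Icc (a := a) (b := b)).exists_bound_of_continuousOn
      (hW x).continuousOn
    exact ⟨C, fun t => hC t t.2⟩
  exact ⟨C, fun t ht => hC ⟨t, ht⟩⟩

/-- A strongly continuous family of bounded operators is jointly continuous. -/
theorem continuous_uncurry_of_strongly_continuous [CompleteSpace B] {W : ℝ → B →L[ℝ] B}
    (hW : ∀ x, Continuous fun t => W t x) : Continuous fun p : ℝ × B => W p.1 p.2 := by
  rw [continuous_iff_continuousAt]
  rintro ⟨t₀, x₀⟩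
  obtain ⟨C, hC⟩ := exists_norm_le_of_strongly_continuous hW (t₀ - 1) (t₀ + 1)
  rw [ContinuousAt, tendsto_iff_dist_tendsto_zero]
  have hlim : Tendsto (fun p : ℝ × B => C * ‖p.2 - x₀‖ + ‖W p.1 x₀ - W t₀ x₀‖)
      (𝓝 (t₀, x₀)) (𝓝 0) := by
    have hc : Continuous fun p : ℝ × B => C * ‖p.2 - x₀‖ + ‖W p.1 x₀ - W t₀ x₀‖ := by
      have := (hW x₀).comp (continuous_fst (X := ℝ) (Y := B))
      exact (continuous_const.mul (continuous_snd.sub continuous_const).norm).add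
        (this.sub continuous_const).norm
    simpa using hc.tendsto (t₀, x₀)
  refine squeeze_zero' (Eventually.of_forall fun _ => dist_nonneg) ?_ hlim
  have hnear : ∀ᶠ p : ℝ × B in 𝓝 (t₀, x₀), p.1 ∈ Set.Icc (t₀ - 1) (t₀ + 1) :=
    continuous_fst.continuousAt.eventually (Icc_mem_nhds (by simp) (by simp))
  filter_upwards [hnear] with p hp
  have h1 : W p.1 p.2 - W t₀ x₀ = W p.1 (p.2 - x₀) + (W p.1 x₀ - W t₀ x₀) := by
    rw [map_sub]; abel
  rw [dist_eq_norm, h1]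
  refine (norm_add_le _ _).trans ?_
  gcongr
  exact (W p.1).le_of_opNorm_le (hC p.1 hp) _

theorem norm_integral_le_of_norm_le_exp {ν : ℝ} (hν : 0 < ν) {C r : ℝ} (hC : 0 ≤ C) (hr : 0 ≤ r)
    {h : ℝ → B} (hh : ∀ s, 0 ≤ s → s ≤ r → ‖h s‖ ≤ C * Real.exp (-ν * s)) :
    ‖∫ s in (0 : ℝ)..r, h s‖ ≤ C / ν := by
  have hprim : ∫ s in (0 : ℝ)..r, C * Real.exp (-ν * s) = C / ν * (1 - Real.exp (-ν * r)) := by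
    have hder : ∀ s ∈ Set.uIcc 0 r,
        HasDerivAt (fun s => -(C / ν) * Real.exp (-ν * s)) (C * Real.exp (-ν * s)) s := by
      intro s _
      have h1 : HasDerivAt (fun s : ℝ => -ν * s) (-ν) s := by
        simpa using (hasDerivAt_id s).const_mul (-ν)
      have h2 := (h1.exp).const_mul (-(C / ν))
      have h3 : -(C / ν) * (Real.exp (-ν * s) * -ν) = C * Real.exp (-ν * s) := by
        field_simp
      rwa [h3] at h2
    rw [intervalIntegral.integral_eq_sub_of_hasDerivAt hder
      ((by fun_prop : Continuous fun s => C * Real.exp (-ν * s)).intervalIntegrable _ _)]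
    simp; ring
  have h1 : ‖∫ s in (0 : ℝ)..r, h s‖ ≤ ∫ s in (0 : ℝ)..r, C * Real.exp (-ν * s) := by
    refine intervalIntegral.norm_integral_le_of_norm_le hr ?_
      ((by fun_prop : Continuous fun s => C * Real.exp (-ν * s)).intervalIntegrable _ _)
    exact Eventually.of_forall fun s hs => hh s hs.1.le hs.2
  rw [hprim] at h1
  refine h1.trans ?_
  have : 0 ≤ C / ν := by positivity
  nlinarith [Real.exp_pos (-ν * r)]

/-- `x` is a mild solution of `x' = A x + g` on `[a, ∞)`, where `A` generates `S`. The variation of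
constants formula is required between any two times, not only from the initial time `a`. -/
def IsMildFrom (S : ℝ → B →L[ℝ] B) (a : ℝ) (x g : ℝ → B) : Prop :=
  ∀ t, a ≤ t → ∀ r, 0 ≤ r → x (t + r) = S r (x t) + ∫ s in (0 : ℝ)..r, S (r - s) (g (t + s))

variable {S V : ℝ → B →L[ℝ] B} {P : B →L[ℝ] B} {N ν : ℝ}

theorem IsMildFrom.mono {a b : ℝ} {x g : ℝ → B} (h : IsMildFrom S a x g) (hab : a ≤ b) :
    IsMildFrom S b x g := fun t ht r hr => h t (hab.trans ht) r hr

theorem IsMildFrom.translate {a h : ℝ} {x g : ℝ → B} (hx : IsMildFrom S a x g) :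
    IsMildFrom S (a - h) (fun t => x (t + h)) (fun t => g (t + h)) := by
  intro t ht r hr
  have := hx (t + h) (by linarith) r hr
  simpa only [add_right_comm t] using this

theorem IsMildFrom.congr {a : ℝ} {x x' g g' : ℝ → B} (h : IsMildFrom S a x g)
    (hx : ∀ t, a ≤ t → x t = x' t) (hg : ∀ t, a ≤ t → g t = g' t) : IsMildFrom S a x' g' := by
  intro t ht r hr
  rw [← hx _ ht, ← hx _ (by linarith), h t ht r hr]
  congr 1
  refine intervalIntegral.integral_congr fun s hs => ?_
  rw [Set.uIcc_of_le hr] at hs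
  rw [hg _ (by linarith [hs.1])]

variable [CompleteSpace B]

theorem ExpDichotomy.continuous_S (hD : ExpDichotomy S V P N ν) {r t : ℝ} {g : ℝ → B}
    (hg : Continuous g) : Continuous fun s => S (r - s) (g (t + s)) :=
  (continuous_uncurry_of_strongly_continuous hD.S_cont).comp
    (f := fun s => (r - s, g (t + s))) (by fun_prop)

theorem ExpDichotomy.continuous_V (hD : ExpDichotomy S V P N ν) {t : ℝ} {g : ℝ → B}
    (hg : Continuous g) : Continuous fun s => V s (g (t + s)) :=
  (continuous_uncurry_of_strongly_continuous hD.V_cont).comp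
    (f := fun s => (s, g (t + s))) (by fun_prop)

theorem IsMildFrom.sub (hD : ExpDichotomy S V P N ν) {a : ℝ} {x x' g g' : ℝ → B}
    (h : IsMildFrom S a x g) (h' : IsMildFrom S a x' g') (hg : Continuous g)
    (hg' : Continuous g') : IsMildFrom S a (fun t => x t - x' t) (fun t => g t - g' t) := by
  intro t ht r hr
  simp only [map_sub]
  rw [h t ht r hr, h' t ht r hr, intervalIntegral.integral_sub
    ((hD.continuous_S hg).intervalIntegrable _ _) ((hD.continuous_S hg').intervalIntegrable _ _)]
  abel

/-- The stable component of a mild solution is determined by the past. -/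
theorem IsMildFrom.norm_stable_le (hD : ExpDichotomy S V P N ν) {a : ℝ} {x g : ℝ → B}
    (h : IsMildFrom S a x g) (hg : Continuous g) {D : ℝ} (hgD : ∀ t, a ≤ t → ‖g t‖ ≤ D)
    {t r : ℝ} (ht : a ≤ t) (hr : 0 ≤ r) :
    ‖P (x (t + r))‖ ≤ ‖S r (P (x t))‖ + N / ν * D := by
  have hN := hD.N_pos
  have hν := hD.ν_pos
  have hD0 : 0 ≤ D := (norm_nonneg _).trans (hgD t ht)
  have h1 : P (x (t + r)) = S r (P (x t)) + ∫ s in (0 : ℝ)..r, S s (P (g (t + (r - s)))) := by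
    rw [h t ht r hr, map_add, ← hD.comm,
      ← P.intervalIntegral_comp_comm ((hD.continuous_S hg).intervalIntegrable _ _)]
    congr 1
    have h2 := intervalIntegral.integral_comp_sub_left (a := 0) (b := r)
      (fun s => P (S (r - s) (g (t + s)))) r
    simp only [sub_sub_cancel, sub_self, sub_zero] at h2
    rw [← h2]
    simp only [hD.comm]
  rw [h1]
  refine (norm_add_le _ _).trans ?_
  gcongr
  have h3 := norm_integral_le_of_norm_le_exp hν (C := N * D) (by positivity) hr
    (h := fun s => S s (P (g (t + (r - s))))) (fun s hs hsr => by
      refine (hD.stable s hs _).trans ?_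
      have := hgD (t + (r - s)) (by linarith)
      calc N * Real.exp (-ν * s) * ‖g (t + (r - s))‖ ≤ N * Real.exp (-ν * s) * D := by gcongr
        _ = _ := by ring)
  rwa [mul_div_right_comm] at h3

/-- The unstable component of a mild solution is determined by the future. -/
theorem IsMildFrom.norm_unstable_le (hD : ExpDichotomy S V P N ν) {a : ℝ} {x g : ℝ → B}
    (h : IsMildFrom S a x g) (hg : Continuous g) {D : ℝ} (hgD : ∀ t, a ≤ t → ‖g t‖ ≤ D)
    {t r : ℝ} (ht : a ≤ t) (hr : 0 ≤ r) :
    ‖x t - P (x t)‖ ≤ N * Real.exp (-ν * r) * ‖x (t + r)‖ + N / ν * D := by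
  have hN := hD.N_pos
  have hν := hD.ν_pos
  have hD0 : 0 ≤ D := (norm_nonneg _).trans (hgD t ht)
  have h1 : x t - P (x t) = V r (x (t + r)) - ∫ s in (0 : ℝ)..r, V s (g (t + s)) := by
    rw [h t ht r hr, map_add, hD.V_S r hr,
      ← (V r).intervalIntegral_comp_comm ((hD.continuous_S hg).intervalIntegrable _ _)]
    have h2 : ∫ s in (0 : ℝ)..r, V r (S (r - s) (g (t + s))) =
        ∫ s in (0 : ℝ)..r, V s (g (t + s)) := by
      refine intervalIntegral.integral_congr fun s hs => ?_
      rw [Set.uIcc_of_le hr] at hs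
      have h3 := hD.V_add s (r - s) hs.1 (by linarith [hs.2]) (S (r - s) (g (t + s)))
      rw [add_sub_cancel, hD.V_S _ (by linarith [hs.2]), map_sub, hD.V_P, sub_zero] at h3
      exact h3
    rw [h2]; abel
  rw [h1]
  refine (norm_sub_le _ _).trans ?_
  gcongr
  · exact hD.unstable r hr _
  · have h3 := norm_integral_le_of_norm_le_exp hν (C := N * D) (by positivity) hr
      (h := fun s => V s (g (t + s))) (fun s hs hsr => by
        refine (hD.unstable s hs _).trans ?_
        have := hgD (t + s) (by linarith)
        calc N * Real.exp (-ν * s) * ‖g (t + s)‖ ≤ N * Real.exp (-ν * s) * D := by gcongr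
          _ = _ := by ring)
    rwa [mul_div_right_comm] at h3

/-- A priori bound: on `[a + r, ∞)` a bounded mild solution is controlled by its forcing, up to an
error that is exponentially small in `r`. -/
theorem IsMildFrom.norm_le (hD : ExpDichotomy S V P N ν) {a : ℝ} {x g : ℝ → B}
    (h : IsMildFrom S a x g) (hg : Continuous g) {D M : ℝ} (hgD : ∀ t, a ≤ t → ‖g t‖ ≤ D)
    (hxM : ∀ t, a ≤ t → ‖x t‖ ≤ M) {t r : ℝ} (hr : 0 ≤ r) (ht : a + r ≤ t) :
    ‖x t‖ ≤ 2 * N * Real.exp (-ν * r) * M + 2 * N / ν * D := by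
  have hN := hD.N_pos
  have h1 := h.norm_stable_le hD hg hgD (t := t - r) (r := r) (by linarith) hr
  have h2 := h.norm_unstable_le hD hg hgD (t := t) (r := r) (by linarith) hr
  rw [sub_add_cancel] at h1
  have h3 := hD.stable r hr (x (t - r))
  have h4 : N * Real.exp (-ν * r) * ‖x (t - r)‖ ≤ N * Real.exp (-ν * r) * M := by
    gcongr; exact hxM _ (by linarith)
  have h5 : N * Real.exp (-ν * r) * ‖x (t + r)‖ ≤ N * Real.exp (-ν * r) * M := by
    gcongr; exact hxM _ (by linarith)
  have h6 : ‖x t‖ ≤ ‖P (x t)‖ + ‖x t - P (x t)‖ := by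
    have := norm_add_le (P (x t)) (x t - P (x t))
    rwa [add_sub_cancel] at this
  calc ‖x t‖ ≤ _ := h6
    _ ≤ (N * Real.exp (-ν * r) * M + N / ν * D) + (N * Real.exp (-ν * r) * M + N / ν * D) := by
      linarith
    _ = _ := by ring

/-- A bounded mild solution whose initial value has no stable component is controlled by its
forcing alone. -/
theorem IsMildFrom.norm_le_of_proj_eq_zero (hD : ExpDichotomy S V P N ν) {a : ℝ} {x g : ℝ → B}
    (h : IsMildFrom S a x g) (hg : Continuous g) {D M : ℝ} (hgD : ∀ t, a ≤ t → ‖g t‖ ≤ D)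
    (hxM : ∀ t, a ≤ t → ‖x t‖ ≤ M) (hP : P (x a) = 0) {t : ℝ} (ht : a ≤ t) :
    ‖x t‖ ≤ 2 * N / ν * D := by
  have hN := hD.N_pos
  have hν := hD.ν_pos
  have h1 := h.norm_stable_le hD hg hgD (t := a) (r := t - a) le_rfl (by linarith)
  rw [add_sub_cancel, hP, map_zero, norm_zero, zero_add] at h1
  have h2 : ‖x t - P (x t)‖ ≤ N / ν * D := by
    have hlim : Tendsto (fun r : ℝ => N * Real.exp (-ν * r) * M + N / ν * D) atTop
        (𝓝 (N * 0 * M + N / ν * D)) := by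
      have : Tendsto (fun r : ℝ => Real.exp (-ν * r)) atTop (𝓝 0) :=
        Real.tendsto_exp_atBot.comp (tendsto_id.const_mul_atTop_of_neg (by linarith))
      exact ((this.const_mul N).mul_const M).add_const _
    simp only [mul_zero, zero_mul, zero_add] at hlim
    refine ge_of_tendsto hlim ?_
    filter_upwards [eventually_ge_atTop 0] with r hr
    refine (h.norm_unstable_le hD hg hgD ht hr).trans ?_
    gcongr
    exact hxM _ (by linarith)
  have h6 : ‖x t‖ ≤ ‖P (x t)‖ + ‖x t - P (x t)‖ := by
    have := norm_add_le (P (x t)) (x t - P (x t))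
    rwa [add_sub_cancel] at this
  calc ‖x t‖ ≤ N / ν * D + N / ν * D := by linarith
    _ = _ := by ring

end Mild

/-! ### Linear inhomogeneous equations -/

section Linear

variable {B : Type u} [NormedAddCommGroup B] [NormedSpace ℝ B]

theorem totallyBounded_of_approx {α : Type*} [PseudoMetricSpace α] {s : Set α}
    (h : ∀ ε : ℝ, 0 < ε → ∃ K : Set α, TotallyBounded K ∧ ∀ x ∈ s, ∃ y ∈ K, dist x y ≤ ε) :
    TotallyBounded s := by
  rw [Metric.totallyBounded_iff]
  intro ε hε
  obtain ⟨K, hK, hs⟩ := h (ε / 2) (by positivity)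
  obtain ⟨t, ht, hKt⟩ := Metric.totallyBounded_iff.1 hK (ε / 2) (by positivity)
  refine ⟨t, ht, fun x hx => ?_⟩
  obtain ⟨y, hy, hxy⟩ := hs x hx
  obtain ⟨z, hz, hyz⟩ := Set.mem_iUnion₂.1 (hKt hy)
  refine Set.mem_iUnion₂.2 ⟨z, hz, ?_⟩
  rw [Metric.mem_ball] at hyz ⊢
  linarith [dist_triangle x y z]

variable [CompleteSpace B]

/-- Integrals, over intervals of bounded length, of functions with values in a fixed compact set
lie in a compact set: the average is in the closed convex hull. -/
theorem exists_compact_integral_mem {K : Set B} (hK : IsCompact K) (T : ℝ) :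
    ∃ C : Set B, IsCompact C ∧ ∀ r, 0 ≤ r → r ≤ T → ∀ h : ℝ → B, Continuous h →
      (∀ s, 0 ≤ s → s ≤ r → h s ∈ K) → ∫ s in (0 : ℝ)..r, h s ∈ C := by
  have hH : IsCompact (closure (convexHull ℝ K)) :=
    (hK.totallyBounded.convexHull.closure).isCompact_of_isClosed isClosed_closure
  refine ⟨(fun p : ℝ × B => p.1 • p.2) '' (Set.Icc 0 T ×ˢ closure (convexHull ℝ K)),
    (isCompact_Icc.prod hH).image (by fun_prop), fun r hr hrT h hc hhK => ?_⟩
  rcases hr.eq_or_lt with rfl | hr0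
  · refine ⟨(0, h 0), ⟨⟨le_rfl, hrT⟩, subset_closure (subset_convexHull ℝ K ?_)⟩, by simp⟩
    exact hhK 0 le_rfl le_rfl
  · have hmem : r⁻¹ • ∫ s in (0 : ℝ)..r, h s ∈ closure (convexHull ℝ K) := by
      have h1 := Convex.set_average_mem (μ := MeasureTheory.volume) (t := Set.Ioc 0 r) (f := h)
        (convex_convexHull ℝ K).closure isClosed_closure (by simp [hr0]) (by simp)
        ((MeasureTheory.ae_restrict_iff' measurableSet_Ioc).2 (Eventually.of_forall fun s hs =>
          subset_closure (subset_convexHull ℝ K (hhK s hs.1.le hs.2))))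
        (hc.integrableOn_Icc.mono_set Set.Ioc_subset_Icc_self)
      rw [← Set.uIoc_of_le hr, interval_average_eq, sub_zero] at h1
      exact h1
    exact ⟨(r, _), ⟨⟨hr, hrT⟩, hmem⟩, smul_inv_smul₀ hr0.ne' _⟩

variable {S V : ℝ → B →L[ℝ] B} {P : B →L[ℝ] B} {N ν : ℝ}

/-- Mild solutions with values in a compact set and bounded forcing are uniformly continuous. -/
theorem IsMildFrom.exists_delta (hD : ExpDichotomy S V P N ν) {a : ℝ} {x g : ℝ → B}
    (h : IsMildFrom S a x g) {K : Set B} (hK : IsCompact K) (hxK : ∀ t, a ≤ t → x t ∈ K)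
    {D : ℝ} (hgD : ∀ t, a ≤ t → ‖g t‖ ≤ D) {ε : ℝ} (hε : 0 < ε) :
    ∃ δ > 0, ∀ s t, a ≤ s → a ≤ t → |s - t| < δ → dist (x s) (x t) < ε := by
  obtain ⟨C, hC⟩ := exists_norm_le_of_strongly_continuous hD.S_cont 0 1
  have hCD : 0 ≤ C * D := mul_nonneg ((norm_nonneg _).trans (hC 0 (by simp)))
    ((norm_nonneg _).trans (hgD a le_rfl))
  have h1 : ∀ᶠ r : ℝ in 𝓝 0, ∀ y ∈ K, ‖S r y - y‖ < ε / 2 := by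
    refine hK.eventually_forall_of_forall_eventually fun y _ => ?_
    have hc : Continuous fun p : ℝ × B => ‖S p.1 p.2 - p.2‖ :=
      ((continuous_uncurry_of_strongly_continuous hD.S_cont).sub continuous_snd).norm
    have h2 := hc.tendsto (0, y)
    simp only [hD.S_zero, sub_self, norm_zero] at h2
    exact h2.eventually (gt_mem_nhds (by positivity))
  have h2 : ∀ᶠ r : ℝ in 𝓝 0, C * D * |r| < ε / 2 := by
    have hc : Continuous fun r : ℝ => C * D * |r| := by fun_prop
    have h2 := hc.tendsto 0
    simp only [abs_zero, mul_zero] at h2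
    exact h2.eventually (gt_mem_nhds (by positivity))
  obtain ⟨δ, hδ, hball⟩ := Metric.eventually_nhds_iff.1
    ((h1.and h2).and (Metric.ball_mem_nhds (0 : ℝ) one_pos))
  have key : ∀ s t, a ≤ s → s ≤ t → |s - t| < δ → dist (x s) (x t) < ε := by
    intro s t hs hst hd
    have hr : 0 ≤ t - s := by linarith
    obtain ⟨⟨hr1, hr2⟩, hr3⟩ := hball (y := t - s) (by
      rwa [Real.dist_eq, sub_zero, abs_sub_comm])
    rw [dist_zero_right, Real.norm_eq_abs, abs_of_nonneg hr] at hr3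
    have hx := h s hs (t - s) hr
    rw [add_sub_cancel] at hx
    have h5 : ‖∫ u in (0 : ℝ)..(t - s), S (t - s - u) (g (s + u))‖ ≤ C * D * |t - s - 0| := by
      refine intervalIntegral.norm_integral_le_of_norm_le_const fun u hu => ?_
      rw [Set.uIoc_of_le hr] at hu
      exact ((S _).le_of_opNorm_le (hC _ ⟨by linarith [hu.2], by linarith [hu.1]⟩) _).trans
        (mul_le_mul_of_nonneg_left (hgD _ (by linarith [hu.1]))
          ((norm_nonneg _).trans (hC 0 (by simp))))
    rw [sub_zero] at h5
    rw [dist_comm, dist_eq_norm, hx, add_sub_right_comm]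
    have := norm_add_le (S (t - s) (x s) - x s)
      (∫ u in (0 : ℝ)..(t - s), S (t - s - u) (g (s + u)))
    have h6 := hr1 _ (hxK s hs)
    linarith
  refine ⟨δ, hδ, fun s t hs ht hd => ?_⟩
  rcases le_total s t with hst | hst
  · exact key s t hs hst hd
  · rw [dist_comm]; exact key t s ht hst (by rwa [abs_sub_comm])

/-- If the forcing takes values in a compact set, the inhomogeneous equation has a mild solution on
`[0, ∞)` with values in a compact set and without stable component at `0`. It is
`∫₀ᵗ S(t - s) P g(s) ds - ∫₀^∞ V(s) g(t + s) ds`. -/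
theorem ExpDichotomy.exists_mild (hD : ExpDichotomy S V P N ν) {g : ℝ → B} (hg : Continuous g)
    {K : Set B} (hK : IsCompact K) (hgK : ∀ t, g t ∈ K) :
    ∃ (x : ℝ → B) (K' : Set B), IsCompact K' ∧ (∀ t, 0 ≤ t → x t ∈ K') ∧
      IsMildFrom S 0 x g ∧ P (x 0) = 0 := by
  have hN := hD.N_pos
  have hν := hD.ν_pos
  obtain ⟨G, hG⟩ := hK.isBounded.exists_norm_le
  have hgG : ∀ t, ‖g t‖ ≤ G := fun t => hG _ (hgK t)
  have hG0 : 0 ≤ G := (norm_nonneg _).trans (hgG 0)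
  have hPg : Continuous fun t => P (g t) := P.continuous.comp hg
  -- the unstable part
  have hVbd : ∀ t s, 0 ≤ s → ‖V s (g (t + s))‖ ≤ N * G * Real.exp (-ν * s) := by
    intro t s hs
    refine (hD.unstable s hs _).trans ?_
    calc N * Real.exp (-ν * s) * ‖g (t + s)‖ ≤ N * Real.exp (-ν * s) * G := by
          gcongr; exact hgG _
      _ = _ := by ring
  have hVint : ∀ t, MeasureTheory.IntegrableOn (fun s => V s (g (t + s))) (Set.Ioi 0) := by
    intro t
    refine MeasureTheory.Integrable.mono' ((exp_neg_integrableOn_Ioi 0 hν).const_mul (N * G))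
      (hD.continuous_V hg).aestronglyMeasurable ?_
    exact (MeasureTheory.ae_restrict_iff' measurableSet_Ioi).2
      (Eventually.of_forall fun s hs => hVbd t s (le_of_lt hs))
  let z : ℝ → B := fun t => ∫ s in Set.Ioi 0, V s (g (t + s))
  have hzlim : ∀ t, Tendsto (fun R => ∫ s in (0 : ℝ)..R, V s (g (t + s))) atTop (𝓝 (z t)) :=
    fun t => MeasureTheory.intervalIntegral_tendsto_integral_Ioi 0 (hVint t) tendsto_id
  have hzbd : ∀ t, ‖z t‖ ≤ N * G / ν := fun t =>
    le_of_tendsto (hzlim t).norm ((eventually_ge_atTop 0).mono fun R hR =>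
      norm_integral_le_of_norm_le_exp hν (by positivity) hR fun s hs _ => hVbd t s hs)
  have hPz : ∀ t, P (z t) = 0 := by
    intro t
    refine tendsto_nhds_unique ((P.continuous.tendsto _).comp (hzlim t)) ?_
    refine tendsto_const_nhds.congr fun R => ?_
    rw [Function.comp_apply,
      ← P.intervalIntegral_comp_comm ((hD.continuous_V hg).intervalIntegrable _ _)]
    simp [hD.P_V]
  have hzsplit : ∀ t r, 0 ≤ r →
      z t = (∫ s in (0 : ℝ)..r, V s (g (t + s))) + V r (z (t + r)) := by
    intro t r hr
    have h1 : Tendsto (fun R => (∫ s in (0 : ℝ)..r, V s (g (t + s))) +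
        V r (∫ s in (0 : ℝ)..(R - r), V s (g (t + r + s)))) atTop
        (𝓝 ((∫ s in (0 : ℝ)..r, V s (g (t + s))) + V r (z (t + r)))) := by
      have h2 := (hzlim (t + r)).comp (tendsto_atTop_add_const_right atTop (-r) tendsto_id)
      exact (((V r).continuous.tendsto _).comp h2).const_add _
    refine tendsto_nhds_unique (hzlim t) (h1.congr' ?_)
    filter_upwards [eventually_ge_atTop r] with R hR
    rw [← (V r).intervalIntegral_comp_comm ((hD.continuous_V hg).intervalIntegrable _ _),
      ← intervalIntegral.integral_add_adjacent_intervals (a := 0) (b := r) (c := R)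
        ((hD.continuous_V hg).intervalIntegrable _ _)
        ((hD.continuous_V hg).intervalIntegrable _ _)]
    congr 1
    have h3 := intervalIntegral.integral_comp_add_right (a := 0) (b := R - r)
      (fun s => V s (g (t + s))) r
    rw [zero_add, sub_add_cancel] at h3
    rw [← h3]
    refine intervalIntegral.integral_congr fun s hs => ?_
    rw [Set.uIcc_of_le (by linarith)] at hs
    change V r (V s (g (t + r + s))) = V (s + r) (g (t + (s + r)))
    rw [add_comm s r, hD.V_add r s hr hs.1, add_assoc]
  have hzS : ∀ t r, 0 ≤ r →
      z (t + r) = S r (z t) - ∫ s in (0 : ℝ)..r, S (r - s) (g (t + s) - P (g (t + s))) := by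
    intro t r hr
    have h1 : S r (z t) = (∫ s in (0 : ℝ)..r, S r (V s (g (t + s)))) + z (t + r) := by
      conv_lhs => rw [hzsplit t r hr]
      rw [map_add, hD.S_V r hr, hPz, sub_zero,
        ← (S r).intervalIntegral_comp_comm ((hD.continuous_V hg).intervalIntegrable _ _)]
    have h2 : ∫ s in (0 : ℝ)..r, S r (V s (g (t + s))) =
        ∫ s in (0 : ℝ)..r, S (r - s) (g (t + s) - P (g (t + s))) := by
      refine intervalIntegral.integral_congr fun s hs => ?_
      rw [Set.uIcc_of_le hr] at hs
      rw [← hD.S_V s hs.1, ← hD.S_add _ _ (by linarith [hs.2]) hs.1, sub_add_cancel]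
    rw [h1, h2]; abel
  -- the stable part
  let y : ℝ → B := fun t => ∫ s in (0 : ℝ)..t, S (t - s) (P (g s))
  have hyP : ∀ t, P (y t) = y t := by
    intro t
    have hc := hD.continuous_S (r := t) (t := 0) hPg
    simp only [zero_add] at hc
    change P (∫ s in (0 : ℝ)..t, S (t - s) (P (g s))) = ∫ s in (0 : ℝ)..t, S (t - s) (P (g s))
    rw [← P.intervalIntegral_comp_comm (hc.intervalIntegrable _ _)]
    simp only [← hD.comm, hD.proj]
  have hyS : ∀ t r, 0 ≤ t → 0 ≤ r →
      y (t + r) = S r (y t) + ∫ s in (0 : ℝ)..r, S (r - s) (P (g (t + s))) := by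
    intro t r ht hr
    have hc : ∀ q, Continuous fun s => S (q - s) (P (g s)) := fun q => by
      simpa only [zero_add] using hD.continuous_S (r := q) (t := 0) hPg
    change ∫ s in (0 : ℝ)..(t + r), S (t + r - s) (P (g s)) =
      S r (∫ s in (0 : ℝ)..t, S (t - s) (P (g s))) + _
    rw [← (S r).intervalIntegral_comp_comm ((hc t).intervalIntegrable _ _),
      ← intervalIntegral.integral_add_adjacent_intervals (b := t)
        ((hc _).intervalIntegrable _ _) ((hc _).intervalIntegrable _ _)]
    congr 1
    · refine intervalIntegral.integral_congr fun s hs => ?_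
      rw [Set.uIcc_of_le ht] at hs
      change S (t + r - s) (P (g s)) = S r (S (t - s) (P (g s)))
      rw [← hD.S_add r _ hr (by linarith [hs.2])]
      congr 2; ring
    · have h3 := intervalIntegral.integral_comp_add_left (a := 0) (b := r)
        (fun s => S (t + r - s) (P (g s))) t
      rw [add_zero] at h3
      rw [← h3]
      simp only [add_sub_add_left_eq_sub]
  have hybd : ∀ t, 0 ≤ t → ‖y t‖ ≤ N * G / ν := by
    intro t ht
    have h2 := intervalIntegral.integral_comp_sub_left (a := 0) (b := t)
      (fun s => S (t - s) (P (g s))) t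
    simp only [sub_sub_cancel, sub_self, sub_zero] at h2
    change ‖∫ s in (0 : ℝ)..t, S (t - s) (P (g s))‖ ≤ _
    rw [← h2]
    refine norm_integral_le_of_norm_le_exp hν (by positivity) ht fun s hs _ => ?_
    refine (hD.stable s hs _).trans ?_
    calc N * Real.exp (-ν * s) * ‖g (t - s)‖ ≤ N * Real.exp (-ν * s) * G := by
          gcongr; exact hgG _
      _ = _ := by ring
  have hy0 : y 0 = 0 := by simp [y]
  -- values of the solution are within any `ε` of integrals over intervals of bounded length
  have htot : TotallyBounded ((fun t => y t - z t) '' Set.Ici 0) := by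
    refine totallyBounded_of_approx fun ε hε => ?_
    obtain ⟨T, hT0, hT⟩ : ∃ T : ℝ, 0 ≤ T ∧
        2 * (N * Real.exp (-ν * T) * (N * G / ν)) ≤ ε := by
      have hlim : Tendsto (fun r : ℝ => 2 * (N * Real.exp (-ν * r) * (N * G / ν))) atTop
          (𝓝 (2 * (N * 0 * (N * G / ν)))) := by
        have : Tendsto (fun r : ℝ => Real.exp (-ν * r)) atTop (𝓝 0) :=
          Real.tendsto_exp_atBot.comp (tendsto_id.const_mul_atTop_of_neg (by linarith))
        exact ((this.const_mul N).mul_const _).const_mul 2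
      simp only [mul_zero, zero_mul] at hlim
      obtain ⟨T, hT0, hT⟩ := ((eventually_ge_atTop 0).and
        (hlim.eventually (gt_mem_nhds hε))).exists
      exact ⟨T, hT0, hT.le⟩
    have hKS : IsCompact ((fun p : ℝ × B => S p.1 (P p.2)) '' (Set.Icc 0 T ×ˢ K)) :=
      (isCompact_Icc.prod hK).image ((continuous_uncurry_of_strongly_continuous hD.S_cont).comp
        (f := fun p : ℝ × B => (p.1, P p.2)) (by fun_prop))
    have hKV : IsCompact ((fun p : ℝ × B => V p.1 p.2) '' (Set.Icc 0 T ×ˢ K)) :=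
      (isCompact_Icc.prod hK).image (continuous_uncurry_of_strongly_continuous hD.V_cont)
    obtain ⟨C₁, hC₁, hmem₁⟩ := exists_compact_integral_mem hKS T
    obtain ⟨C₂, hC₂, hmem₂⟩ := exists_compact_integral_mem hKV T
    refine ⟨(fun p : B × B => p.1 - p.2) '' (C₁ ×ˢ C₂),
      ((hC₁.prod hC₂).image continuous_sub).totallyBounded, ?_⟩
    rintro _ ⟨t, ht, rfl⟩
    obtain ⟨r, hr0, hrT, hrt, hSr⟩ : ∃ r, 0 ≤ r ∧ r ≤ T ∧ r ≤ t ∧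
        ‖S r (y (t - r))‖ ≤ N * Real.exp (-ν * T) * (N * G / ν) := by
      rcases le_total t T with htT | htT
      · refine ⟨t, ht, htT, le_rfl, ?_⟩
        rw [sub_self, hy0, map_zero, norm_zero]; positivity
      · refine ⟨T, hT0, le_rfl, htT, ?_⟩
        rw [← hyP]
        refine (hD.stable T hT0 _).trans ?_
        gcongr
        exact hybd _ (by linarith)
    refine ⟨_, ⟨(∫ s in (0 : ℝ)..r, S (r - s) (P (g (t - r + s))),
      ∫ s in (0 : ℝ)..T, V s (g (t + s))), ⟨?_, ?_⟩, rfl⟩, ?_⟩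
    · refine hmem₁ r hr0 hrT _ (hD.continuous_S hPg) fun s hs hsr => ?_
      exact ⟨(r - s, g (t - r + s)), ⟨⟨by linarith, by linarith⟩, hgK _⟩, rfl⟩
    · refine hmem₂ T hT0 le_rfl _ (hD.continuous_V hg) fun s hs hsr => ?_
      exact ⟨(s, g (t + s)), ⟨⟨hs, hsr⟩, hgK _⟩, rfl⟩
    · have h1 := hyS (t - r) r (by linarith) hr0
      rw [sub_add_cancel] at h1
      have h2 := hzsplit t T hT0
      have h3 : ‖V T (z (t + T))‖ ≤ N * Real.exp (-ν * T) * (N * G / ν) := by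
        refine (hD.unstable T hT0 _).trans ?_
        gcongr
        exact hzbd _
      have h4 : y t - z t - ((∫ s in (0 : ℝ)..r, S (r - s) (P (g (t - r + s)))) -
          ∫ s in (0 : ℝ)..T, V s (g (t + s))) = S r (y (t - r)) - V T (z (t + T)) := by
        rw [h1, h2]; abel
      simp only [dist_eq_norm, h4]
      have := norm_sub_le (S r (y (t - r))) (V T (z (t + T)))
      linarith
  refine ⟨fun t => y t - z t, closure ((fun t => y t - z t) '' Set.Ici 0),
    htot.closure.isCompact_of_isClosed isClosed_closure,
    fun t ht => subset_closure ⟨t, ht, rfl⟩, fun t ht r hr => ?_, ?_⟩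
  · simp only [map_sub]
    rw [hyS t r ht hr, hzS t r hr]
    have h1 : ∫ s in (0 : ℝ)..r, S (r - s) (g (t + s)) =
        (∫ s in (0 : ℝ)..r, S (r - s) (P (g (t + s)))) +
          ∫ s in (0 : ℝ)..r, S (r - s) (g (t + s) - P (g (t + s))) := by
      have hQg : Continuous fun t => g t - P (g t) := hg.sub hPg
      rw [← intervalIntegral.integral_add ((hD.continuous_S hPg).intervalIntegrable _ _)
        ((hD.continuous_S hQg).intervalIntegrable _ _)]
      simp only [map_sub, add_sub_cancel]
    rw [h1]
    simp only [map_sub]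
    abel
  · simp [hy0, hPz]

end Linear

/-! ### Lagrange stable functions -/

section Lagrange

variable {T : Type v} [AddCommMonoid T] [TopologicalSpace T] [ContinuousAdd T]
variable {X : Type u}

@[simp] theorem timeShift_apply [TopologicalSpace X] (h : T) (φ : C(T, X)) (t : T) :
    timeShift h φ t = φ (h + t) := rfl

theorem timeShift_timeShift [TopologicalSpace X] (h k : T) (φ : C(T, X)) :
    timeShift h (timeShift k φ) = timeShift (k + h) φ := by
  ext t; simp [add_assoc]

theorem continuous_timeShift [TopologicalSpace X] (h : T) :
    Continuous fun φ : C(T, X) => timeShift h φ :=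
  ContinuousMap.continuous_precomp (⟨fun t => h + t, by fun_prop⟩ : C(T, T))

/-- The Arzelà–Ascoli criterion for Lagrange stability. -/
theorem isLagrangeStable_of_equicontinuous [LocallyCompactSpace T] [MetricSpace X] {φ : C(T, X)}
    {K : Set X} (hK : IsCompact K) (hφK : ∀ t, φ t ∈ K)
    (heq : Equicontinuous fun h : T => (timeShift h φ : T → X)) : IsLagrangeStable φ := by
  have hemb : IsClosedEmbedding (UniformOnFun.ofFun {K : Set T | IsCompact K} ∘
      fun ψ : C(T, X) => (ψ : T → X)) := by
    refine ⟨ContinuousMap.isUniformEmbedding_toUniformOnFunIsCompact.isEmbedding, ?_⟩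
    change IsClosed (range (ContinuousMap.toUniformOnFunIsCompact : C(T, X) → _))
    rw [ContinuousMap.range_toUniformOnFunIsCompact]
    exact UniformOnFun.isClosed_setOfPred_continuous CompactlyCoherentSpace.isCoherentWith
  refine ArzelaAscoli.isCompact_closure_of_isClosedEmbedding (fun K hK => hK) hemb ?_ ?_
  · intro C _ t _ U hU
    filter_upwards [nhdsWithin_le_nhds (heq t U hU)] with s hs
    rintro ⟨_, h, rfl⟩
    exact hs h
  · rintro C _ t _
    refine ⟨K, hK, ?_⟩
    rintro _ ⟨h, rfl⟩
    exact hφK _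

/-- The hull of a Lagrange stable function consists of Lagrange stable functions. -/
theorem IsLagrangeStable.of_mem_closure [MetricSpace X] {φ ψ : C(T, X)}
    (h : IsLagrangeStable φ) (hψ : ψ ∈ closure (range fun s : T => timeShift s φ)) :
    IsLagrangeStable ψ := by
  refine h.closure_of_subset ?_
  rintro _ ⟨s, rfl⟩
  refine map_mem_closure (continuous_timeShift s) hψ ?_
  rintro _ ⟨r, rfl⟩
  exact ⟨r + s, (timeShift_timeShift s r φ).symm⟩

theorem isLagrangeStable_of_modulus_nnreal [MetricSpace X] {φ : C(ℝ≥0, X)} {K : Set X}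
    (hK : IsCompact K) (hφK : ∀ t, φ t ∈ K)
    (hφ : ∀ ε > 0, ∃ δ > 0, ∀ s t : ℝ≥0, dist s t < δ → dist (φ s) (φ t) < ε) :
    IsLagrangeStable φ := by
  refine isLagrangeStable_of_equicontinuous hK hφK ?_
  intro t
  rw [Metric.equicontinuousAt_iff]
  intro ε hε
  obtain ⟨δ, hδ, h⟩ := hφ ε hε
  refine ⟨δ, hδ, fun s hs r => h _ _ ?_⟩
  rwa [NNReal.dist_eq, NNReal.coe_add, NNReal.coe_add, add_sub_add_left_eq_sub, abs_sub_comm,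
    ← NNReal.dist_eq]

theorem isLagrangeStable_of_modulus_real [MetricSpace X] {φ : C(ℝ, X)} {K : Set X}
    (hK : IsCompact K) (hφK : ∀ t, φ t ∈ K)
    (hφ : ∀ ε > 0, ∃ δ > 0, ∀ s t : ℝ, dist s t < δ → dist (φ s) (φ t) < ε) :
    IsLagrangeStable φ := by
  refine isLagrangeStable_of_equicontinuous hK hφK ?_
  intro t
  rw [Metric.equicontinuousAt_iff]
  intro ε hε
  obtain ⟨δ, hδ, h⟩ := hφ ε hε
  refine ⟨δ, hδ, fun s hs r => h _ _ ?_⟩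
  rwa [dist_add_left, dist_comm]

/-- A Lagrange stable function of time and space maps `ℝ≥0 × K`, for `K` compact, into a compact
set. -/
theorem IsLagrangeStableParam.exists_compact {B : Type u} [NormedAddCommGroup B]
    {F : C(ℝ≥0 × B, B)} (hF : IsLagrangeStableParam F) {K : Set B} (hK : IsCompact K) :
    ∃ C : Set B, IsCompact C ∧ ∀ t, ∀ y ∈ K, F (t, y) ∈ C := by
  have : CompactSpace K := isCompact_iff_compactSpace.1 hK
  let ι : C(K, ℝ≥0 × B) := ⟨fun y => (0, y), by fun_prop⟩
  have hR : Continuous fun G : C(ℝ≥0 × B, B) => G.comp ι := ContinuousMap.continuous_precomp ι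
  have hev : Continuous fun p : C(K, B) × K => p.1 p.2 := by fun_prop
  refine ⟨_, ((IsCompact.image hF hR).prod isCompact_univ).image hev, fun t y hy => ?_⟩
  refine ⟨((timeShiftParam t F).comp ι, ⟨y, hy⟩),
    ⟨⟨_, subset_closure ⟨t, rfl⟩, rfl⟩, mem_univ _⟩, ?_⟩
  simp [timeShiftParam, ι]

end Lagrange

/-! ### Existence and uniqueness for the semilinear equation -/

section Semilinear

variable {B : Type u} [NormedAddCommGroup B]

/-- The forcing `f(t) + F(t, φ(t))`, extended to `ℝ` by its value at `0`. -/
def semilinearForcing (f : C(ℝ≥0, B)) (F : C(ℝ≥0 × B, B)) (φ : ℝ≥0 → B) (t : ℝ) : B :=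
  f t.toNNReal + F (t.toNNReal, φ t.toNNReal)

theorem continuous_semilinearForcing (f : C(ℝ≥0, B)) (F : C(ℝ≥0 × B, B)) {φ : ℝ≥0 → B}
    (hφ : Continuous φ) : Continuous (semilinearForcing f F φ) := by
  unfold semilinearForcing
  have := continuous_real_toNNReal
  fun_prop

theorem exists_compact_semilinearForcing {f : C(ℝ≥0, B)} {F : C(ℝ≥0 × B, B)}
    (hf : IsLagrangeStable f) (hF : IsLagrangeStableParam F) {K : Set B} (hK : IsCompact K) :
    ∃ C : Set B, IsCompact C ∧ ∀ φ : ℝ≥0 → B, (∀ t, φ t ∈ K) →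
      ∀ t, semilinearForcing f F φ t ∈ C := by
  obtain ⟨C, hC, hFC⟩ := hF.exists_compact hK
  refine ⟨_, (hf.isCompact_closure_range.prod hC).image continuous_add, fun φ hφ t => ?_⟩
  exact ⟨(_, _), ⟨subset_closure (mem_range_self _), hFC _ _ (hφ _)⟩, rfl⟩

theorem norm_semilinearForcing_sub_le {f : C(ℝ≥0, B)} {F : C(ℝ≥0 × B, B)} {L : ℝ≥0}
    (hL : ∀ t : ℝ≥0, LipschitzWith L fun x : B => F (t, x)) {φ ψ : ℝ≥0 → B} {m : ℝ}
    (hm : ∀ t, dist (φ t) (ψ t) ≤ m) (t : ℝ) :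
    ‖semilinearForcing f F φ t - semilinearForcing f F ψ t‖ ≤ L * m := by
  unfold semilinearForcing
  rw [add_sub_add_left_eq_sub, ← dist_eq_norm]
  refine ((hL _).dist_le_mul _ _).trans ?_
  gcongr
  exact hm _

variable [NormedSpace ℝ B] [CompleteSpace B] {S V : ℝ → B →L[ℝ] B} {P : B →L[ℝ] B} {N ν : ℝ}

/-- The variation of constants formula with initial time `0` implies it for all initial times. -/
theorem IsMildFrom.of_initial (hD : ExpDichotomy S V P N ν) {x g : ℝ → B} (hg : Continuous g)
    (h : ∀ t, 0 ≤ t → x t = S t (x 0) + ∫ s in (0 : ℝ)..t, S (t - s) (g s)) :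
    IsMildFrom S 0 x g := by
  intro t ht r hr
  have hc : ∀ q, Continuous fun s => S (q - s) (g s) := fun q => by
    simpa only [zero_add] using hD.continuous_S (r := q) (t := 0) hg
  rw [h (t + r) (by linarith), h t ht, map_add,
    ← (S r).intervalIntegral_comp_comm ((hc t).intervalIntegrable _ _),
    ← intervalIntegral.integral_add_adjacent_intervals (a := 0) (b := t) (c := t + r)
      ((hc _).intervalIntegrable _ _) ((hc _).intervalIntegrable _ _),
    add_comm t r, hD.S_add r t hr ht, add_assoc]
  congr 2
  · refine intervalIntegral.integral_congr fun s hs => ?_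
    rw [Set.uIcc_of_le ht] at hs
    change S (r + t - s) (g s) = S r (S (t - s) (g s))
    rw [← hD.S_add r _ hr (by linarith [hs.2])]
    congr 2; ring
  · have h3 := intervalIntegral.integral_comp_add_left (a := 0) (b := r)
      (fun s => S (r + t - s) (g s)) t
    rw [add_zero, add_comm t r] at h3
    rw [← h3]
    refine intervalIntegral.integral_congr fun s _ => ?_
    congr 2; ring

/-- A mild solution on the half-line with values in a compact set and bounded forcing is Lagrange
stable. -/
theorem IsMildFrom.isLagrangeStable (hD : ExpDichotomy S V P N ν) {φ : C(ℝ≥0, B)} {g : ℝ → B}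
    (h : IsMildFrom S 0 (fun t => φ t.toNNReal) g) {K : Set B} (hK : IsCompact K)
    (hφK : ∀ t, φ t ∈ K) {D : ℝ} (hgD : ∀ t, 0 ≤ t → ‖g t‖ ≤ D) : IsLagrangeStable φ := by
  refine isLagrangeStable_of_modulus_nnreal hK hφK fun ε hε => ?_
  obtain ⟨δ, hδ, hd⟩ := h.exists_delta hD hK (fun t _ => hφK _) hgD hε
  refine ⟨δ, hδ, fun s t hst => ?_⟩
  simpa using hd s t s.2 t.2 (by rwa [← NNReal.dist_eq])

/-- Two bounded mild solutions of the semilinear equation without stable component at `0`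
coincide. -/
theorem IsMildFrom.eq_of_proj_eq_zero (hD : ExpDichotomy S V P N ν) {f : C(ℝ≥0, B)}
    {F : C(ℝ≥0 × B, B)} {L : ℝ≥0} (hL : ∀ t : ℝ≥0, LipschitzWith L fun x : B => F (t, x))
    (hLν : (L : ℝ) < ν / (2 * N)) {φ ψ : C(ℝ≥0, B)} {M : ℝ} (hφM : ∀ t, ‖φ t‖ ≤ M)
    (hψM : ∀ t, ‖ψ t‖ ≤ M)
    (hφ : IsMildFrom S 0 (fun t => φ t.toNNReal) (semilinearForcing f F φ))
    (hψ : IsMildFrom S 0 (fun t => ψ t.toNNReal) (semilinearForcing f F ψ))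
    (hφ0 : P (φ 0) = 0) (hψ0 : P (ψ 0) = 0) : φ = ψ := by
  have hN := hD.N_pos
  have hν := hD.ν_pos
  have hκ : 2 * N / ν * L < 1 := by
    rw [lt_div_iff₀ (by positivity)] at hLν
    rw [div_mul_eq_mul_div, div_lt_one hν]; linarith
  have hcf := continuous_semilinearForcing f F φ.continuous
  have hcg := continuous_semilinearForcing f F ψ.continuous
  have hiter : ∀ n : ℕ, ∀ t, dist (φ t) (ψ t) ≤ (2 * N / ν * L) ^ n * (2 * M) := by
    intro n
    induction n with
    | zero =>
      intro t
      rw [dist_eq_norm, pow_zero, one_mul]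
      linarith [norm_sub_le (φ t) (ψ t), hφM t, hψM t]
    | succ n ih =>
      intro t
      have h1 := (hφ.sub hD hψ hcf hcg).norm_le_of_proj_eq_zero hD (hcf.sub hcg)
        (fun s _ => norm_semilinearForcing_sub_le hL ih s) (M := 2 * M)
        (fun s _ => (norm_sub_le _ _).trans (by linarith [hφM s.toNNReal, hψM s.toNNReal]))
        (by simp [hφ0, hψ0]) (NNReal.coe_nonneg t)
      rw [Real.toNNReal_coe, ← dist_eq_norm] at h1
      calc _ ≤ _ := h1
        _ = _ := by ring
  ext t
  have hlim := (tendsto_pow_atTop_nhds_zero_of_lt_one (by positivity) hκ).mul_const (2 * M)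
  rw [zero_mul] at hlim
  exact dist_le_zero.1 (ge_of_tendsto' hlim fun n => hiter n t)

/-- The semilinear equation has a mild solution with values in a compact set and without stable
component at `0`: the solution operator of the linear equation, composed with the superposition
operator of `F`, is a contraction of the complete space of bounded continuous functions with totally
bounded range. -/
theorem ExpDichotomy.exists_semilinear (hD : ExpDichotomy S V P N ν) {f : C(ℝ≥0, B)}
    {F : C(ℝ≥0 × B, B)} (hf : IsLagrangeStable f) (hF : IsLagrangeStableParam F) {L : ℝ≥0}
    (hL : ∀ t : ℝ≥0, LipschitzWith L fun x : B => F (t, x)) (hLν : (L : ℝ) < ν / (2 * N)) :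
    ∃ φ : C(ℝ≥0, B), IsLagrangeStable φ ∧
      IsMildFrom S 0 (fun t => φ t.toNNReal) (semilinearForcing f F φ) ∧ P (φ 0) = 0 := by
  have hN := hD.N_pos
  have hν := hD.ν_pos
  have hκ : 2 * N / ν * L < 1 := by
    rw [lt_div_iff₀ (by positivity)] at hLν
    rw [div_mul_eq_mul_div, div_lt_one hν]; linarith
  let E := {φ : BoundedContinuousFunction ℝ≥0 B // TotallyBounded (range φ)}
  have hclosed : IsClosed {φ : BoundedContinuousFunction ℝ≥0 B | TotallyBounded (range φ)} := by
    refine isClosed_of_closure_subset fun φ hφ => totallyBounded_of_approx fun ε hε => ?_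
    obtain ⟨ψ, hψ, hd⟩ := Metric.mem_closure_iff.1 hφ ε hε
    refine ⟨range ψ, hψ, ?_⟩
    rintro _ ⟨t, rfl⟩
    exact ⟨ψ t, mem_range_self t, (BoundedContinuousFunction.dist_coe_le_dist t).trans hd.le⟩
  have : CompleteSpace E := hclosed.completeSpace_coe
  have : Nonempty E := ⟨⟨0, (finite_singleton (0 : B)).totallyBounded.subset (by
    rintro _ ⟨t, rfl⟩; simp)⟩⟩
  -- the linear solution operator
  have hex : ∀ φ : E, ∃ ψ : E,
      IsMildFrom S 0 (fun t => ψ.1 t.toNNReal) (semilinearForcing f F φ.1) ∧ P (ψ.1 0) = 0 := by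
    intro φ
    have hK : IsCompact (closure (range φ.1)) :=
      φ.2.closure.isCompact_of_isClosed isClosed_closure
    obtain ⟨C, hC, hmem⟩ := exists_compact_semilinearForcing hf hF hK
    have hgC := hmem φ.1 fun t => subset_closure (mem_range_self t)
    obtain ⟨x, K', hK', hxK', hx, hx0⟩ :=
      hD.exists_mild (continuous_semilinearForcing f F φ.1.continuous) hC hgC
    obtain ⟨D, hCD⟩ := hC.isBounded.exists_norm_le
    obtain ⟨M, hM⟩ := hK'.isBounded.exists_norm_le
    have hcont : Continuous fun t : ℝ≥0 => x t := by
      rw [Metric.continuous_iff]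
      intro t ε hε
      obtain ⟨δ, hδ, hd⟩ := hx.exists_delta hD hK' hxK' (fun t _ => hCD _ (hgC t)) hε
      exact ⟨δ, hδ, fun s hs => hd s t s.2 t.2 (by rwa [← NNReal.dist_eq])⟩
    refine ⟨⟨.ofNormedAddCommGroup (fun t : ℝ≥0 => x t) hcont M fun t => hM _ (hxK' t t.2),
      hK'.totallyBounded.subset ?_⟩, hx.congr (fun t ht => ?_) fun _ _ => rfl, ?_⟩
    · rintro _ ⟨t, rfl⟩
      exact hxK' t t.2
    · simp [ht]
    · simpa using hx0
  choose Γ hΓ hΓ0 using hex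
  have hcontr : ContractingWith (2 * N / ν * L).toNNReal Γ := by
    refine ⟨Real.toNNReal_lt_one.2 hκ, LipschitzWith.of_dist_le_mul fun φ ψ => ?_⟩
    have hφψ : ∀ t, dist (φ.1 t) (ψ.1 t) ≤ dist φ ψ := fun t =>
      BoundedContinuousFunction.dist_coe_le_dist t
    rw [Real.coe_toNNReal _ (by positivity)]
    change dist (Γ φ).1 (Γ ψ).1 ≤ 2 * N / ν * L * dist φ ψ
    rw [BoundedContinuousFunction.dist_le (by positivity)]
    intro t
    have hcf := continuous_semilinearForcing f F φ.1.continuous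
    have hcg := continuous_semilinearForcing f F ψ.1.continuous
    have h1 := ((hΓ φ).sub hD (hΓ ψ) hcf hcg).norm_le_of_proj_eq_zero hD (hcf.sub hcg)
      (fun s _ => norm_semilinearForcing_sub_le hL hφψ s) (M := ‖(Γ φ).1‖ + ‖(Γ ψ).1‖)
      (fun s _ => (norm_sub_le _ _).trans
        (add_le_add ((Γ φ).1.norm_coe_le_norm _) ((Γ ψ).1.norm_coe_le_norm _)))
      (by simp [hΓ0]) (NNReal.coe_nonneg t)
    rw [Real.toNNReal_coe, ← dist_eq_norm] at h1
    calc _ ≤ _ := h1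
      _ = _ := by ring
  let φ := hcontr.fixedPoint
  have hfix : Γ φ = φ := hcontr.fixedPoint_isFixedPt
  have hmild := hΓ φ
  have hmild0 := hΓ0 φ
  rw [hfix] at hmild hmild0
  have hK : IsCompact (closure (range φ.1)) := φ.2.closure.isCompact_of_isClosed isClosed_closure
  obtain ⟨C, hC, hmem⟩ := exists_compact_semilinearForcing hf hF hK
  obtain ⟨D, hCD⟩ := hC.isBounded.exists_norm_le
  exact ⟨φ.1.toContinuousMap, IsMildFrom.isLagrangeStable hD (φ := φ.1.toContinuousMap) hmild hK
    (fun t => subset_closure (mem_range_self t))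
    fun t _ => hCD _ (hmem φ.1 (fun t => subset_closure (mem_range_self t)) t), hmild, hmild0⟩

end Semilinear

/-! ### Equations with coefficients in `B × C(Q, B)` -/

section Coefficients

variable {B : Type u} [NormedAddCommGroup B] {Q : Compacts B}

/-- The forcing `c₁(t) + c₂(t)(x(t))` of the equation with coefficients `c = (c₁, c₂)`. -/
def coefficientForcing (c : ℝ → B × C(Q, B)) (x : ℝ → Q) (t : ℝ) : B :=
  (c t).1 + (c t).2 (x t)

variable {L : ℝ≥0} {G a : ℝ} {c c₁ c₂ : ℝ → B × C(Q, B)} {x x₁ x₂ : ℝ → Q}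

theorem norm_coefficientForcing_sub_le {t ε : ℝ} (h : LipschitzWith L (c₂ t).2)
    (hε : dist (c₁ t) (c₂ t) ≤ ε) :
    ‖coefficientForcing c₁ x₁ t - coefficientForcing c₂ x₂ t‖ ≤
      2 * ε + L * ‖(x₁ t : B) - x₂ t‖ := by
  have h1 : dist (c₁ t).1 (c₂ t).1 ≤ ε := (le_max_left _ _).trans hε
  have h2 : dist ((c₁ t).2 (x₁ t)) ((c₂ t).2 (x₁ t)) ≤ ε :=
    (ContinuousMap.dist_apply_le_dist _).trans ((le_max_right _ _).trans hε)
  have h3 := h.dist_le_mul (x₁ t) (x₂ t)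
  rw [Subtype.dist_eq, dist_eq_norm (x₁ t : B)] at h3
  rw [← dist_eq_norm]
  have h4 := dist_triangle ((c₁ t).2 (x₁ t)) ((c₂ t).2 (x₁ t)) ((c₂ t).2 (x₂ t))
  have h5 := dist_add_add_le (c₁ t).1 ((c₁ t).2 (x₁ t)) (c₂ t).1 ((c₂ t).2 (x₂ t))
  unfold coefficientForcing
  linarith

variable [NormedSpace ℝ B] {S : ℝ → B →L[ℝ] B}

/-- `x` is a solution on `[a, ∞)`, with values in the compact set `Q`, of the equation
`x' = A x + c₁(t) + c₂(t)(x)`, the coefficient `c₂` being Lipschitz continuous with constant `L` and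
the forcing along `x` being bounded by `G`. -/
structure IsSolutionFrom (S : ℝ → B →L[ℝ] B) (L : ℝ≥0) (G a : ℝ) (c : ℝ → B × C(Q, B))
    (x : ℝ → Q) : Prop where
  continuous_coeff : Continuous c
  continuous_sol : Continuous x
  lipschitz : ∀ t, a ≤ t → LipschitzWith L (c t).2
  bounded : ∀ t, a ≤ t → ‖coefficientForcing c x t‖ ≤ G
  mild : IsMildFrom S a (fun t => (x t : B)) (coefficientForcing c x)

theorem IsSolutionFrom.continuous_forcing (h : IsSolutionFrom S L G a c x) :
    Continuous (coefficientForcing c x) := by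
  have h1 := h.continuous_coeff
  have h2 := h.continuous_sol
  unfold coefficientForcing
  fun_prop

theorem IsSolutionFrom.mono (h : IsSolutionFrom S L G a c x) {b : ℝ} (hab : a ≤ b) :
    IsSolutionFrom S L G b c x where
  continuous_coeff := h.continuous_coeff
  continuous_sol := h.continuous_sol
  lipschitz t ht := h.lipschitz t (hab.trans ht)
  bounded t ht := h.bounded t (hab.trans ht)
  mild := h.mild.mono hab

theorem IsSolutionFrom.translate (h : IsSolutionFrom S L G a c x) (s : ℝ) :
    IsSolutionFrom S L G (a - s) (fun t => c (t + s)) (fun t => x (t + s)) where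
  continuous_coeff := h.continuous_coeff.comp (by fun_prop)
  continuous_sol := h.continuous_sol.comp (by fun_prop)
  lipschitz t ht := h.lipschitz (t + s) (by linarith)
  bounded t ht := h.bounded (t + s) (by linarith)
  mild := h.mild.translate

end Coefficients

/-! ### Comparison of solutions of two equations -/

section Comparison

variable {B : Type u} [NormedAddCommGroup B] [NormedSpace ℝ B] [CompleteSpace B]
variable {S V : ℝ → B →L[ℝ] B} {P : B →L[ℝ] B} {N ν : ℝ}

/-- Pointwise limits of mild solutions are mild solutions. -/
theorem IsMildFrom.of_tendsto (hD : ExpDichotomy S V P N ν) {a G : ℝ} {b : ℕ → ℝ}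
    {xs gs : ℕ → ℝ → B} {x g : ℝ → B} (h : ∀ n, IsMildFrom S (b n) (xs n) (gs n))
    (hb : ∀ᶠ n in atTop, b n ≤ a) (hcont : ∀ n, Continuous (gs n))
    (hx : ∀ t, a ≤ t → Tendsto (fun n => xs n t) atTop (𝓝 (x t)))
    (hg : ∀ t, a ≤ t → Tendsto (fun n => gs n t) atTop (𝓝 (g t)))
    (hG : ∀ n t, b n ≤ t → ‖gs n t‖ ≤ G) : IsMildFrom S a x g := by
  intro t ht r hr
  refine tendsto_nhds_unique (hx (t + r) (by linarith)) ?_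
  obtain ⟨C, hC⟩ := exists_norm_le_of_strongly_continuous hD.S_cont 0 r
  have hint : Tendsto (fun n => ∫ s in (0 : ℝ)..r, S (r - s) (gs n (t + s))) atTop
      (𝓝 (∫ s in (0 : ℝ)..r, S (r - s) (g (t + s)))) := by
    refine intervalIntegral.tendsto_integral_filter_of_dominated_convergence (fun _ => C * G)
      (Eventually.of_forall fun n => (hD.continuous_S (hcont n)).aestronglyMeasurable) ?_
      intervalIntegrable_const (Eventually.of_forall fun s hs => ?_)
    · filter_upwards [hb] with n hn
      refine Eventually.of_forall fun s hs => ?_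
      rw [Set.uIoc_of_le hr] at hs
      have hCr := hC (r - s) ⟨by linarith [hs.2], by linarith [hs.1]⟩
      exact ((S _).le_of_opNorm_le hCr _).trans (mul_le_mul_of_nonneg_left
        (hG n _ (by linarith [hs.1])) ((norm_nonneg _).trans hCr))
    · rw [Set.uIoc_of_le hr] at hs
      exact ((S (r - s)).continuous.tendsto _).comp (hg _ (by linarith [hs.1]))
  refine ((((S r).continuous.tendsto _).comp (hx t ht)).add hint).congr' ?_
  filter_upwards [hb] with n hn
  exact (h n t (hn.trans ht) r hr).symm

/-- The difference of two bounded mild solutions whose forcings differ by at most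
`ε + L * ‖x₁ - x₂‖` is bounded by `ρ ^ k * M + C * ε` after time `k * r`. Using `max ε 0` spares the
hypothesis `0 ≤ ε`. -/
theorem ExpDichotomy.exists_comparison (hD : ExpDichotomy S V P N ν) {L : ℝ} (hL : 0 ≤ L)
    (hLν : L < ν / (2 * N)) :
    ∃ ρ C r : ℝ, 0 ≤ ρ ∧ ρ < 1 ∧ 0 ≤ C ∧ 0 ≤ r ∧ ∀ (a : ℝ) (x₁ x₂ g₁ g₂ : ℝ → B),
      IsMildFrom S a x₁ g₁ → IsMildFrom S a x₂ g₂ → Continuous g₁ → Continuous g₂ →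
      ∀ ε M : ℝ, (∀ t, a ≤ t → ‖g₁ t - g₂ t‖ ≤ ε + L * ‖x₁ t - x₂ t‖) →
        (∀ t, a ≤ t → ‖x₁ t - x₂ t‖ ≤ M) →
        ∀ (k : ℕ) (t : ℝ), a + k * r ≤ t → ‖x₁ t - x₂ t‖ ≤ ρ ^ k * M + C * max ε 0 := by
  have hN := hD.N_pos
  have hν := hD.ν_pos
  have hκ : 2 * N / ν * L < 1 := by
    rw [lt_div_iff₀ (by positivity)] at hLν
    rw [div_mul_eq_mul_div, div_lt_one hν]; linarith
  -- a time after which the exponential term still leaves a contraction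
  obtain ⟨r, hr0, hr⟩ : ∃ r : ℝ, 0 ≤ r ∧ 2 * N * Real.exp (-ν * r) + 2 * N / ν * L < 1 := by
    have hlim : Tendsto (fun r : ℝ => 2 * N * Real.exp (-ν * r) + 2 * N / ν * L) atTop
        (𝓝 (2 * N * 0 + 2 * N / ν * L)) := by
      have : Tendsto (fun r : ℝ => Real.exp (-ν * r)) atTop (𝓝 0) :=
        Real.tendsto_exp_atBot.comp (tendsto_id.const_mul_atTop_of_neg (by linarith))
      exact (this.const_mul (2 * N)).add_const _
    rw [mul_zero, zero_add] at hlim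
    exact ((eventually_ge_atTop 0).and (hlim.eventually (gt_mem_nhds hκ))).exists
  set ρ := 2 * N * Real.exp (-ν * r) + 2 * N / ν * L with hρ
  have hρ0 : 0 ≤ ρ := by positivity
  have h1ρ : 0 < 1 - ρ := by linarith
  refine ⟨ρ, 2 * N / ν / (1 - ρ), r, hρ0, hr, by positivity, hr0,
    fun a x₁ x₂ g₁ g₂ h₁ h₂ hg₁ hg₂ ε M hg hM k => ?_⟩
  induction k with
  | zero =>
    intro t ht
    have : 0 ≤ 2 * N / ν / (1 - ρ) * max ε 0 := by positivity
    rw [Nat.cast_zero, zero_mul, add_zero] at ht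
    linarith [hM t ht]
  | succ k ih =>
    intro t ht
    set m := ρ ^ k * M + 2 * N / ν / (1 - ρ) * max ε 0 with hm
    have hk : 0 ≤ (k : ℝ) * r := by positivity
    push_cast at ht
    have h3 := ((h₁.sub hD h₂ hg₁ hg₂).mono (b := a + k * r) (by linarith)).norm_le hD
      (hg₁.sub hg₂) (D := max ε 0 + L * m) (M := m)
      (fun s hs => (hg s (by linarith)).trans
        (add_le_add (le_max_left _ _) (mul_le_mul_of_nonneg_left (ih s hs) hL)))
      ih hr0 (t := t) (by linarith)
    have h4 : 2 * N / ν / (1 - ρ) * max ε 0 =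
        ρ * (2 * N / ν / (1 - ρ) * max ε 0) + 2 * N / ν * max ε 0 := by
      field_simp; ring
    calc ‖x₁ t - x₂ t‖ ≤ _ := h3
      _ = ρ * m + 2 * N / ν * max ε 0 := by rw [hρ]; ring
      _ = ρ ^ (k + 1) * M + (ρ * (2 * N / ν / (1 - ρ) * max ε 0) + 2 * N / ν * max ε 0) := by
        rw [hm]; ring
      _ = _ := by rw [← h4]

variable {Q : Compacts B} {L : ℝ≥0} {G a : ℝ} {c c₁ c₂ : ℝ → B × C(Q, B)} {x x₁ x₂ : ℝ → Q}

theorem IsSolutionFrom.of_tendsto (hD : ExpDichotomy S V P N ν) {b : ℕ → ℝ}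
    {cs : ℕ → ℝ → B × C(Q, B)} {xs : ℕ → ℝ → Q}
    (h : ∀ n, IsSolutionFrom S L G (b n) (cs n) (xs n)) (hb : ∀ᶠ n in atTop, b n ≤ a)
    (hc : Continuous c) (hx : Continuous x)
    (hcs : ∀ t, a ≤ t → Tendsto (fun n => cs n t) atTop (𝓝 (c t)))
    (hxs : ∀ t, a ≤ t → Tendsto (fun n => xs n t) atTop (𝓝 (x t))) :
    IsSolutionFrom S L G a c x := by
  have hforce : ∀ t, a ≤ t → Tendsto (fun n => coefficientForcing (cs n) (xs n) t) atTop
      (𝓝 (coefficientForcing c x t)) := by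
    intro t ht
    have hev : Continuous fun p : (B × C(Q, B)) × Q => p.1.1 + p.1.2 p.2 := by fun_prop
    exact (hev.tendsto (c t, x t)).comp ((hcs t ht).prodMk_nhds (hxs t ht))
  refine ⟨hc, hx, fun t ht => LipschitzWith.of_dist_le_mul fun y z => ?_, fun t ht => ?_, ?_⟩
  · have hev : ∀ y : Q, Tendsto (fun n => (cs n t).2 y) atTop (𝓝 ((c t).2 y)) := fun y => by
      have hev : Continuous fun p : B × C(Q, B) => p.2 y := by fun_prop
      exact (hev.tendsto (c t)).comp (hcs t ht)
    refine le_of_tendsto ((hev y).dist (hev z)) (hb.mono fun n hn => ?_)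
    exact ((h n).lipschitz t (hn.trans ht)).dist_le_mul y z
  · exact le_of_tendsto (hforce t ht).norm (hb.mono fun n hn => (h n).bounded t (hn.trans ht))
  · exact IsMildFrom.of_tendsto hD (fun n => (h n).mild) hb (fun n => (h n).continuous_forcing)
      (fun t ht => (continuous_subtype_val.tendsto _).comp (hxs t ht)) hforce
      fun n => (h n).bounded

/-- If the coefficients of two equations are eventually within `ε` of each other, their solutions
are eventually within any bound exceeding `C * ε`. -/
theorem ExpDichotomy.exists_eventually_dist_le (hD : ExpDichotomy S V P N ν)
    (hLν : (L : ℝ) < ν / (2 * N)) (Q : Compacts B) :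
    ∃ C : ℝ, 0 ≤ C ∧ ∀ (c₁ c₂ : ℝ → B × C(Q, B)) (x₁ x₂ : ℝ → Q) (a G : ℝ),
      IsSolutionFrom S L G a c₁ x₁ → IsSolutionFrom S L G a c₂ x₂ → ∀ ε, 0 ≤ ε →
      (∀ᶠ t in atTop, dist (c₁ t) (c₂ t) ≤ ε) → ∀ δ, 0 < δ →
      ∀ᶠ t in atTop, dist (x₁ t) (x₂ t) ≤ C * ε + δ := by
  obtain ⟨ρ, C, r, hρ0, hρ1, hC, hr, H⟩ := hD.exists_comparison L.2 hLν
  obtain ⟨M, hM⟩ := Metric.isBounded_iff.1 Q.isCompact.isBounded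
  refine ⟨C * 2, by positivity, fun c₁ c₂ x₁ x₂ a G h₁ h₂ ε hε hd δ hδ => ?_⟩
  obtain ⟨b, hb⟩ := eventually_atTop.1 (hd.and (eventually_ge_atTop a))
  have hab : a ≤ b := (hb b le_rfl).2
  have hlim := (tendsto_pow_atTop_nhds_zero_of_lt_one hρ0 hρ1).mul_const M
  rw [zero_mul] at hlim
  obtain ⟨k, hk⟩ := (hlim.eventually (gt_mem_nhds hδ)).exists
  have h3 := H b _ _ _ _ (h₁.mono hab).mild (h₂.mono hab).mild h₁.continuous_forcing
    h₂.continuous_forcing (2 * ε) M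
    (fun t ht => norm_coefficientForcing_sub_le (h₂.lipschitz t (hab.trans ht)) (hb t ht).1)
    (fun t _ => by rw [← dist_eq_norm]; exact hM (x₁ t).2 (x₂ t).2) k
  filter_upwards [eventually_ge_atTop (b + k * r)] with t ht
  have h4 := h3 t ht
  rw [max_eq_left (by positivity), ← dist_eq_norm, ← Subtype.dist_eq] at h4
  linarith

/-- Solutions of asymptotically equal equations are asymptotically equal. -/
theorem IsSolutionFrom.tendsto_dist (hD : ExpDichotomy S V P N ν) (hLν : (L : ℝ) < ν / (2 * N))
    (h₁ : IsSolutionFrom S L G a c₁ x₁) (h₂ : IsSolutionFrom S L G a c₂ x₂)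
    (hd : Tendsto (fun t => dist (c₁ t) (c₂ t)) atTop (𝓝 0)) :
    Tendsto (fun t => dist (x₁ t) (x₂ t)) atTop (𝓝 0) := by
  obtain ⟨C, hC, H⟩ := hD.exists_eventually_dist_le hLν Q
  rw [Metric.tendsto_nhds]
  intro ε hε
  have h3 : 0 < ε / (2 * (C + 1)) := by positivity
  filter_upwards [H c₁ c₂ x₁ x₂ a G h₁ h₂ _ h3.le
    ((hd.eventually (gt_mem_nhds h3)).mono fun _ h => h.le) (ε / 3) (by positivity)] with t ht
  rw [Real.dist_eq, sub_zero, abs_of_nonneg dist_nonneg]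
  have h4 : C * (ε / (2 * (C + 1))) ≤ ε / 2 := by
    rw [mul_div_assoc', div_le_div_iff₀ (by positivity) (by positivity)]
    nlinarith
  linarith

/-- An equation on the whole line has at most one solution with values in `Q`. -/
theorem IsSolutionFrom.eq_of_entire (hD : ExpDichotomy S V P N ν) (hLν : (L : ℝ) < ν / (2 * N))
    (h₁ : ∀ a, IsSolutionFrom S L G a c x₁) (h₂ : ∀ a, IsSolutionFrom S L G a c x₂) :
    x₁ = x₂ := by
  obtain ⟨ρ, C, r, hρ0, hρ1, hC, hr, H⟩ := hD.exists_comparison L.2 hLν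
  obtain ⟨M, hM⟩ := Metric.isBounded_iff.1 Q.isCompact.isBounded
  funext t
  have hlim := (tendsto_pow_atTop_nhds_zero_of_lt_one hρ0 hρ1).mul_const M
  rw [zero_mul] at hlim
  refine dist_le_zero.1 (ge_of_tendsto' hlim fun k => ?_)
  -- the comparison from the initial time `t - k * r`
  have h3 := H (t - k * r) _ _ _ _ (h₁ _).mild (h₂ _).mild (h₁ 0).continuous_forcing
    (h₂ 0).continuous_forcing (2 * 0) M
    (fun t _ => norm_coefficientForcing_sub_le ((h₂ t).lipschitz t le_rfl) (dist_self _).le)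
    (fun t _ => by rw [← dist_eq_norm]; exact hM (x₁ t).2 (x₂ t).2) k t (by linarith)
  rw [← dist_eq_norm, ← Subtype.dist_eq] at h3
  simpa using h3

end Comparison

/-! ### Limits of translates of a solution on the half-line -/

section HalfLine

variable {B : Type u} [NormedAddCommGroup B] [NormedSpace ℝ B] [CompleteSpace B]
variable {S V : ℝ → B →L[ℝ] B} {P : B →L[ℝ] B} {N ν : ℝ} {Q : Compacts B} {L : ℝ≥0} {G : ℝ}
variable {J p : C(ℝ≥0, B × C(Q, B))} {φ q : C(ℝ≥0, Q)} {σ : ℕ → ℝ≥0}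

theorem toNNReal_add_coe {t : ℝ} (ht : 0 ≤ t) (s : ℝ≥0) :
    (t + s).toNNReal = t.toNNReal + s := by
  rw [Real.toNNReal_add ht (NNReal.coe_nonneg s), Real.toNNReal_coe]

/-- A limit of translates of a solution, along times tending to infinity, solves the limit
equation. -/
theorem IsSolutionFrom.of_translates (hD : ExpDichotomy S V P N ν)
    (hφ : IsSolutionFrom S L G 0 (J ∘ Real.toNNReal) (φ ∘ Real.toNNReal))
    (hJp : ∀ t, Tendsto (fun n => J (t + σ n)) atTop (𝓝 (p t)))
    (hφq : ∀ t, Tendsto (fun n => φ (t + σ n)) atTop (𝓝 (q t))) :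
    IsSolutionFrom S L G 0 (p ∘ Real.toNNReal) (q ∘ Real.toNNReal) := by
  refine IsSolutionFrom.of_tendsto hD (fun n => hφ.translate (σ n))
    (Eventually.of_forall fun n => by simp) (p.continuous.comp continuous_real_toNNReal)
    (q.continuous.comp continuous_real_toNNReal) (fun t ht => ?_) fun t ht => ?_
  · simp only [Function.comp_apply, toNNReal_add_coe ht]
    exact hJp _
  · simp only [Function.comp_apply, toNNReal_add_coe ht]
    exact hφq _

theorem tendsto_comp_toNNReal {u : ℝ≥0 → ℝ} {l : Filter ℝ} (h : Tendsto u atTop l) :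
    Tendsto (u ∘ Real.toNNReal) atTop l :=
  h.comp Real.tendsto_toNNReal_atTop

/-- A solution of an equation with asymptotically given coefficients is asymptotic to every limit of
its translates whose coefficients are the given ones. -/
theorem IsSolutionFrom.tendsto_dist_of_translates (hD : ExpDichotomy S V P N ν)
    (hLν : (L : ℝ) < ν / (2 * N))
    (hφ : IsSolutionFrom S L G 0 (J ∘ Real.toNNReal) (φ ∘ Real.toNNReal))
    (hd : Tendsto (fun t => dist (J t) (p t)) atTop (𝓝 0))
    (hJp : ∀ t, Tendsto (fun n => J (t + σ n)) atTop (𝓝 (p t)))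
    (hφq : ∀ t, Tendsto (fun n => φ (t + σ n)) atTop (𝓝 (q t))) :
    Tendsto (fun t => dist (φ t) (q t)) atTop (𝓝 0) := by
  have h := hφ.tendsto_dist hD hLν (hφ.of_translates hD hJp hφq) (tendsto_comp_toNNReal hd)
  have h2 := h.comp (NNReal.tendsto_coe_atTop.2 tendsto_id)
  simpa [Function.comp_def] using h2

/-- The almost periods of the coefficients are almost periods, up to a constant, of any limit of
translates of a solution. -/
theorem ExpDichotomy.exists_dist_le (hD : ExpDichotomy S V P N ν)
    (hLν : (L : ℝ) < ν / (2 * N)) (Q : Compacts B) :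
    ∃ C : ℝ, 0 ≤ C ∧ ∀ (J p : C(ℝ≥0, B × C(Q, B))) (φ q : C(ℝ≥0, Q)) (σ : ℕ → ℝ≥0) (G : ℝ),
      IsSolutionFrom S L G 0 (J ∘ Real.toNNReal) (φ ∘ Real.toNNReal) →
      Tendsto (fun t => dist (J t) (p t)) atTop (𝓝 0) → Tendsto σ atTop atTop →
      (∀ t, Tendsto (fun n => φ (t + σ n)) atTop (𝓝 (q t))) →
      ∀ τ ε, 0 ≤ ε → (∀ t, dist (p (t + τ)) (p t) ≤ ε) →
      ∀ t, dist (q (t + τ)) (q t) ≤ C * ε := by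
  obtain ⟨C, hC, H⟩ := hD.exists_eventually_dist_le hLν Q
  refine ⟨C, hC, fun J p φ q σ G hφ hd hσ hφq τ ε hε hp t => ?_⟩
  refine le_of_forall_pos_le_add fun δ hδ => ?_
  have hη : 0 < δ / (2 * (C + 1)) := by positivity
  set η := δ / (2 * (C + 1)) with hη_def
  have hCη : C * η ≤ δ / 2 := by
    rw [hη_def, mul_div_assoc', div_le_div_iff₀ (by positivity) (by positivity)]
    nlinarith
  have hJ : ∀ᶠ s : ℝ in atTop, dist (J (s + τ).toNNReal) (J s.toNNReal) ≤ ε + η := by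
    have h1 : ∀ᶠ s in atTop, dist (J s) (p s) < η / 2 := hd.eventually (gt_mem_nhds (by positivity))
    have h2 := (tendsto_atTop_mono (fun s => le_self_add) tendsto_id : Tendsto (fun s => s + τ) atTop
      atTop).eventually h1
    have h3 := Real.tendsto_toNNReal_atTop.eventually (h1.and h2)
    filter_upwards [h3, eventually_ge_atTop 0] with s hs hs0
    rw [toNNReal_add_coe hs0]
    have h4 := dist_triangle4_right (J (s.toNNReal + τ)) (J s.toNNReal) (p (s.toNNReal + τ))
      (p s.toNNReal)
    have h5 := hp s.toNNReal
    have h6 := hs.1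
    have h7 : dist (J (s.toNNReal + τ)) (p (s.toNNReal + τ)) < η / 2 := hs.2
    linarith
  have h1 := H _ _ _ _ 0 G ((hφ.translate τ).mono (by simp)) hφ (ε + η) (by positivity) hJ
    (δ / 2) (by positivity)
  have h2 : ∀ᶠ s : ℝ≥0 in atTop, dist (φ (s + τ)) (φ s) ≤ C * (ε + η) + δ / 2 := by
    filter_upwards [(NNReal.tendsto_coe_atTop.2 tendsto_id).eventually h1] with s hs
    simpa [toNNReal_add_coe s.2] using hs
  have hσt : Tendsto (fun n => t + σ n) atTop atTop := 
    tendsto_atTop_mono (fun n => le_add_self) hσ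
  refine le_of_tendsto ((hφq (t + τ)).dist (hφq t)) ?_
  filter_upwards [hσt.eventually h2] with n hn
  rw [add_right_comm]
  linarith

end HalfLine

/-! ### Kronecker's theorem and functions on the torus -/

section Kronecker

open MeasureTheory UnitAddTorus

variable {k : ℕ}

/-- The linear flow `t ↦ (ν₁ t, …, ν_k t)` on the torus, the circle `ℝ / 2πℤ` being identified with
`ℝ / ℤ`. -/
noncomputable def torusFlow (ν : Fin k → ℝ) (t : ℝ) : UnitAddTorus (Fin k) :=
  fun i => ((ν i * t / (2 * Real.pi) : ℝ) : UnitAddCircle)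

theorem continuous_torusFlow (ν : Fin k → ℝ) : Continuous (torusFlow ν) :=
  continuous_pi fun _ => (AddCircle.continuous_mk' 1).comp (by fun_prop)

theorem torusFlow_add (ν : Fin k → ℝ) (s t : ℝ) :
    torusFlow ν (s + t) = torusFlow ν s + torusFlow ν t := by
  funext i
  simp only [torusFlow, Pi.add_apply, ← AddCircle.coe_add]
  congr 1; ring

theorem mFourier_torusFlow (ν : Fin k → ℝ) (n : Fin k → ℤ) (t : ℝ) :
    mFourier n (torusFlow ν t) = Complex.exp (Complex.I * ↑(∑ i, n i * ν i) * t) := by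
  simp only [mFourier, ContinuousMap.coe_mk, torusFlow, fourier_coe_apply (T := 1), ← Complex.exp_sum]
  congr 1
  push_cast
  rw [Finset.mul_sum, Finset.sum_mul]
  refine Finset.sum_congr rfl fun i _ => ?_
  have := Complex.ofReal_ne_zero.2 Real.pi_ne_zero
  field_simp

/-- The normalized Haar measure of the torus. -/
noncomputable abbrev torusMeasure (k : ℕ) : Measure (UnitAddTorus (Fin k)) :=
  Measure.pi fun _ => AddCircle.haarAddCircle

theorem integral_mFourier (n : Fin k → ℤ) :
    ∫ x, mFourier n x ∂torusMeasure k = if n = 0 then 1 else 0 := by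
  have h := orthonormal_iff_ite.1 (orthonormal_mFourier (d := Fin k)) 0 n
  rw [ContinuousMap.inner_toLp] at h
  simp only [mFourier_zero, ContinuousMap.one_apply, map_one, mul_one] at h
  simp only [eq_comm (a := n)]
  exact h

/-- Weyl's equidistribution theorem: time averages along a flow with rationally independent
frequencies converge to space averages. -/
theorem tendsto_average_torusFlow {ν : Fin k → ℝ} (hν : LinearIndependent ℚ ν)
    (h : C(UnitAddTorus (Fin k), ℂ)) :
    Tendsto (fun T : ℝ => (T : ℂ)⁻¹ * ∫ t in (0 : ℝ)..T, h (torusFlow ν t)) atTop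
      (𝓝 (∫ x, h x ∂torusMeasure k)) := by
  have hint : ∀ g : C(UnitAddTorus (Fin k), ℂ), Integrable g (torusMeasure k) := fun g =>
    g.continuous.integrable_of_hasCompactSupport (HasCompactSupport.of_compactSpace g)
  have hcont : ∀ g : C(UnitAddTorus (Fin k), ℂ), Continuous fun t => g (torusFlow ν t) := fun g =>
    g.continuous.comp (continuous_torusFlow ν)
  -- the statement for characters
  have hmon : ∀ n : Fin k → ℤ, Tendsto (fun T : ℝ => (T : ℂ)⁻¹ *
      ∫ t in (0 : ℝ)..T, mFourier n (torusFlow ν t)) atTop (𝓝 (∫ x, mFourier n x ∂torusMeasure k)) := by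
    intro n
    rw [integral_mFourier]
    split_ifs with hn
    · subst hn
      refine tendsto_const_nhds.congr' ?_
      filter_upwards [eventually_gt_atTop 0] with T hT
      have : (T : ℂ) ≠ 0 := by exact_mod_cast hT.ne'
      simp [mFourier_zero, this]
    · have hl : (∑ i, n i * ν i : ℝ) ≠ 0 := by
        intro h0
        apply hn
        have h1 := Fintype.linearIndependent_iff.1 hν (fun i => (n i : ℚ)) (by
          simpa [Rat.smul_def] using h0)
        funext i
        exact_mod_cast h1 i
      set l : ℝ := ∑ i, n i * ν i
      have hl' : Complex.I * (l : ℂ) ≠ 0 :=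
        mul_ne_zero Complex.I_ne_zero (by exact_mod_cast hl)
      simp only [mFourier_torusFlow]
      have hb : ∀ T : ℝ, 0 < T → ‖(T : ℂ)⁻¹ * ∫ t in (0 : ℝ)..T,
          Complex.exp (Complex.I * (l : ℂ) * t)‖ ≤ T⁻¹ * (2 / |l|) := by
        intro T hT
        rw [integral_exp_mul_complex hl', norm_mul, norm_inv, norm_div, Complex.norm_real,
          Real.norm_of_nonneg hT.le]
        have he : ∀ s : ℝ, ‖Complex.exp (Complex.I * (l : ℂ) * s)‖ = 1 := fun s => by
          rw [show Complex.I * (l : ℂ) * s = ((l * s : ℝ) : ℂ) * Complex.I by push_cast; ring]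
          exact Complex.norm_exp_ofReal_mul_I _
        gcongr
        · refine (norm_sub_le _ _).trans ?_
          rw [he, he]; norm_num
        · simp
      refine squeeze_zero_norm' ((eventually_gt_atTop 0).mono hb) ?_
      simpa using tendsto_inv_atTop_zero.mul_const (2 / |l|)
  -- linear combinations of characters
  have hspan : ∀ g ∈ Submodule.span ℂ (range (mFourier (d := Fin k))),
      Tendsto (fun T : ℝ => (T : ℂ)⁻¹ * ∫ t in (0 : ℝ)..T, g (torusFlow ν t)) atTop
        (𝓝 (∫ x, g x ∂torusMeasure k)) := by
    intro g hg
    induction hg using Submodule.span_induction with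
    | mem g hg => obtain ⟨n, rfl⟩ := hg; exact hmon n
    | zero => simp
    | add g₁ g₂ _ _ h₁ h₂ =>
      have h3 := h₁.add h₂
      rw [← integral_add (hint g₁) (hint g₂)] at h3
      refine h3.congr fun T => ?_
      rw [← mul_add, ← intervalIntegral.integral_add ((hcont g₁).intervalIntegrable _ _)
        ((hcont g₂).intervalIntegrable _ _)]
      simp
    | smul c g _ h₁ =>
      have h3 := h₁.const_mul c
      rw [← integral_const_mul] at h3
      refine h3.congr fun T => ?_
      simp only [ContinuousMap.smul_apply, smul_eq_mul, intervalIntegral.integral_const_mul]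
      ring
  -- uniform limits
  have hdense : h ∈ closure (Submodule.span ℂ (range (mFourier (d := Fin k))) :
      Set C(UnitAddTorus (Fin k), ℂ)) := by
    have := span_mFourier_closure_eq_top (d := Fin k)
    rw [← Submodule.topologicalClosure_coe, this]
    trivial
  rw [Metric.tendsto_nhds]
  intro ε hε
  obtain ⟨g, hg, hgd⟩ := Metric.mem_closure_iff.1 hdense (ε / 3) (by positivity)
  have hpt : ∀ x, ‖h x - g x‖ ≤ ε / 3 := fun x => by
    rw [← dist_eq_norm]; exact (ContinuousMap.dist_apply_le_dist x).trans hgd.le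
  filter_upwards [(Metric.tendsto_nhds.1 (hspan g hg)) (ε / 3) (by positivity),
    eventually_gt_atTop 0] with T hT hT0
  have h1 : dist ((T : ℂ)⁻¹ * ∫ t in (0 : ℝ)..T, h (torusFlow ν t))
      ((T : ℂ)⁻¹ * ∫ t in (0 : ℝ)..T, g (torusFlow ν t)) ≤ ε / 3 := by
    rw [dist_eq_norm, ← mul_sub, ← intervalIntegral.integral_sub ((hcont h).intervalIntegrable _ _)
      ((hcont g).intervalIntegrable _ _), norm_mul, norm_inv, Complex.norm_real,
      Real.norm_of_nonneg hT0.le, inv_mul_le_iff₀ hT0]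
    have := intervalIntegral.norm_integral_le_of_norm_le_const (a := 0) (b := T)
      (f := fun t => h (torusFlow ν t) - g (torusFlow ν t)) fun t _ => hpt (torusFlow ν t)
    rw [sub_zero, abs_of_pos hT0] at this
    linarith
  have h2 : dist (∫ x, g x ∂torusMeasure k) (∫ x, h x ∂torusMeasure k) ≤ ε / 3 := by
    rw [dist_comm, dist_eq_norm, ← integral_sub (hint h) (hint g)]
    refine (norm_integral_le_of_norm_le_const (Eventually.of_forall hpt)).trans ?_
    simp
  have h3 := dist_triangle4 ((T : ℂ)⁻¹ * ∫ t in (0 : ℝ)..T, h (torusFlow ν t))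
    ((T : ℂ)⁻¹ * ∫ t in (0 : ℝ)..T, g (torusFlow ν t)) (∫ x, g x ∂torusMeasure k) (∫ x, h x ∂torusMeasure k)
  linarith

/-- Kronecker's theorem: a flow with rationally independent frequencies comes arbitrarily close to
every point of the torus at arbitrarily late times. -/
theorem exists_dist_torusFlow_lt {ν : Fin k → ℝ} (hν : LinearIndependent ℚ ν)
    (θ : UnitAddTorus (Fin k)) {ε : ℝ} (hε : 0 < ε) (T₀ : ℝ) :
    ∃ t, T₀ ≤ t ∧ dist (torusFlow ν t) θ < ε := by
  by_contra! hcon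
  -- a bump function at `θ` that vanishes along the flow from time `T₀` on
  let b : UnitAddTorus (Fin k) → ℝ := fun x => max 0 (ε - dist x θ)
  have hb : Continuous b := by fun_prop
  have hpos : 0 < ∫ x, b x ∂torusMeasure k :=
    hb.integral_pos_of_hasCompactSupport_nonneg_nonzero (HasCompactSupport.of_compactSpace b)
      (fun x => le_max_left _ _) (x := θ) (by simp [b, hε.ne', hε.le])
  let h : C(UnitAddTorus (Fin k), ℂ) := ⟨fun x => (b x : ℂ), by fun_prop⟩
  have hlim := tendsto_average_torusFlow hν h
  have hzero : Tendsto (fun T : ℝ => (T : ℂ)⁻¹ * ∫ t in (0 : ℝ)..T, h (torusFlow ν t)) atTop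
      (𝓝 0) := by
    have h1 : Tendsto (fun T : ℝ => (T : ℂ)⁻¹ * ∫ t in (0 : ℝ)..T₀, h (torusFlow ν t)) atTop
        (𝓝 0) := by
      have : Tendsto (fun T : ℝ => ((T⁻¹ : ℝ) : ℂ)) atTop (𝓝 ((0 : ℝ) : ℂ)) :=
        (Complex.continuous_ofReal.tendsto 0).comp tendsto_inv_atTop_zero
      simpa using this.mul_const (∫ t in (0 : ℝ)..T₀, h (torusFlow ν t))
    refine h1.congr' ?_
    filter_upwards [eventually_ge_atTop T₀] with T hT
    have hc : Continuous fun t => h (torusFlow ν t) := h.continuous.comp (continuous_torusFlow ν)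
    rw [← intervalIntegral.integral_add_adjacent_intervals (a := 0) (b := T₀) (c := T)
      (hc.intervalIntegrable _ _) (hc.intervalIntegrable _ _)]
    have h2 : ∫ t in T₀..T, h (torusFlow ν t) = ∫ t in T₀..T, (0 : ℂ) := by
      refine intervalIntegral.integral_congr fun t ht => ?_
      rw [Set.uIcc_of_le hT] at ht
      have := hcon t ht.1
      simp [h, b, this]
    rw [h2]; simp
  have h0 := tendsto_nhds_unique hlim hzero
  have h3 : ∫ x, h x ∂torusMeasure k = ((∫ x, b x ∂torusMeasure k : ℝ) : ℂ) := integral_ofReal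
  rw [h3] at h0
  exact hpos.ne' (by exact_mod_cast h0)

/-- A continuous function on `ℝᵏ` that is `2π`-periodic in each variable is a function on the
torus. -/
theorem exists_torus_factor {X : Type u} [TopologicalSpace X] {Φ : C(Fin k → ℝ, X)}
    (hΦ : ∀ (θ : Fin k → ℝ) (i : Fin k), Φ (Function.update θ i (θ i + 2 * Real.pi)) = Φ θ) :
    ∃ Ψ : C(UnitAddTorus (Fin k), X), ∀ θ : Fin k → ℝ,
      Ψ (fun i => ((θ i / (2 * Real.pi) : ℝ) : UnitAddCircle)) = Φ θ := by
  have hpi : (2 * Real.pi) ≠ 0 := by positivity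
  have hint : ∀ (m : ℤ) (θ : Fin k → ℝ) (i : Fin k),
      Φ (Function.update θ i (θ i + m * (2 * Real.pi))) = Φ θ := by
    intro m
    induction m using Int.induction_on with
    | zero => intro θ i; simp
    | succ m ih =>
      intro θ i
      have h1 := hΦ (Function.update θ i (θ i + m * (2 * Real.pi))) i
      rw [Function.update_self, Function.update_idem, add_assoc, ← add_one_mul] at h1
      push_cast
      rw [h1]
      exact_mod_cast ih θ i
    | pred m ih =>
      intro θ i
      have h1 := hΦ (Function.update θ i (θ i + (-m - 1 : ℤ) * (2 * Real.pi))) i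
      rw [Function.update_self, Function.update_idem, add_assoc, ← add_one_mul] at h1
      rw [← h1]
      have h2 := ih θ i
      push_cast at h2 ⊢
      rwa [sub_add_cancel]
  let π : C(Fin k → ℝ, UnitAddTorus (Fin k)) :=
    ⟨Pi.map fun _ => ((↑) : ℝ → UnitAddCircle), by
      exact continuous_pi fun i => (AddCircle.continuous_mk' 1).comp (continuous_apply i)⟩
  have hquot : IsQuotientMap π :=
    (IsOpenQuotientMap.piMap fun _ => QuotientAddGroup.isOpenQuotientMap_mk).isQuotientMap
  let Φ' : C(Fin k → ℝ, X) := ⟨fun θ => Φ fun i => 2 * Real.pi * θ i, by fun_prop⟩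
  have hfac : Function.FactorsThrough Φ' π := by
    intro θ θ' h
    -- replace the coordinates of one point by those of the other, one at a time
    have hs : ∀ s : Finset (Fin k), Φ' (s.piecewise θ' θ) = Φ' θ := by
      intro s
      induction s using Finset.induction_on with
      | empty => simp
      | insert j s hj ih =>
        rw [Finset.piecewise_insert, ← ih]
        have h1 : ((θ j : ℝ) : UnitAddCircle) = (θ' j : ℝ) := congrFun h j
        rw [← sub_eq_zero, ← AddCircle.coe_sub, AddCircle.coe_eq_zero_iff] at h1
        obtain ⟨m, hm⟩ := h1
        have h2 := hint (-m) (fun i => 2 * Real.pi * s.piecewise θ' θ i) j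
        have h3 : (s.piecewise θ' θ) j = θ j := by simp [hj]
        rw [h3] at h2
        change Φ _ = Φ _
        rw [← h2]
        congr 1
        funext i
        rcases eq_or_ne i j with rfl | hij
        · simp only [Function.update_self]
          have h4 : θ' i = θ i - m := by
            simp only [zsmul_eq_mul, mul_one] at hm
            linarith
          rw [h4]; push_cast; ring
        · simp only [Function.update_of_ne hij]
    have := hs Finset.univ
    rw [Finset.piecewise_univ] at this
    exact this.symm
  refine ⟨hquot.lift Φ' hfac, fun θ => ?_⟩
  have h1 := DFunLike.congr_fun (hquot.lift_comp Φ' hfac) fun i => θ i / (2 * Real.pi)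
  have h2 : Φ' (fun i => θ i / (2 * Real.pi)) = Φ θ := by
    simp only [Φ', ContinuousMap.coe_mk]
    congr 1; funext i; field_simp
  rw [← h2]
  exact h1

/-- A function of time which is uniformly continuous with respect to the position on a torus of a
flow with rationally independent frequencies is a continuous function of that position. -/
theorem exists_torus_extension {ν : Fin k → ℝ} (hν : LinearIndependent ℚ ν) {Y : Type u}
    [MetricSpace Y] [CompleteSpace Y] {q : ℝ≥0 → Y}
    (hq : ∀ ε > 0, ∃ δ > 0, ∀ s t : ℝ≥0, dist (torusFlow ν s) (torusFlow ν t) < δ →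
      dist (q s) (q t) < ε) :
    ∃ Ψ : C(UnitAddTorus (Fin k), Y), ∀ t : ℝ≥0, Ψ (torusFlow ν t) = q t := by
  let R : Set (UnitAddTorus (Fin k)) := range fun t : ℝ≥0 => torusFlow ν t
  have hdense : DenseRange ((↑) : R → UnitAddTorus (Fin k)) := by
    rw [DenseRange, Subtype.range_coe]
    refine Metric.dense_iff.2 fun θ ε hε => ?_
    obtain ⟨t, ht, hd⟩ := exists_dist_torusFlow_lt hν θ hε 0
    exact ⟨_, hd, ⟨⟨t, ht⟩, rfl⟩⟩
  choose τ hτ using fun x : R => x.2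
  have hu : UniformContinuous fun x : R => q (τ x) := by
    rw [Metric.uniformContinuous_iff]
    intro ε hε
    obtain ⟨δ, hδ, h⟩ := hq ε hε
    refine ⟨δ, hδ, fun x y hxy => h _ _ ?_⟩
    have hx : torusFlow ν (τ x) = x := hτ x
    have hy : torusFlow ν (τ y) = y := hτ y
    rwa [hx, hy]
  have hind : IsUniformInducing ((↑) : R → UnitAddTorus (Fin k)) := isUniformInducing_val R
  refine ⟨⟨_, (uniformContinuous_uniformly_extend hind hdense hu).continuous⟩, fun t => ?_⟩
  have h1 := uniformly_extend_of_ind hind hdense hu ⟨torusFlow ν t, ⟨t, rfl⟩⟩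
  refine h1.trans (dist_le_zero.1 (le_of_forall_pos_lt_add fun ε hε => ?_))
  obtain ⟨δ, hδ, h⟩ := hq ε hε
  rw [zero_add]
  refine h _ _ ?_
  have hx : torusFlow ν (τ ⟨torusFlow ν t, ⟨t, rfl⟩⟩) = torusFlow ν t := hτ _
  rwa [hx, dist_self]

end Kronecker

/-! ### Minimal sets and recurrence -/

section Minimal

variable {Z : Type u} [TopologicalSpace Z] {σ : ℝ≥0 → Z → Z} {K M : Set Z}

/-- A nonempty compact set invariant under a semigroup of maps contains a minimal nonempty closed
invariant set. -/
theorem IsCompact.exists_minimal_invariant (hK : IsCompact K) (hKc : IsClosed K)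
    (hne : K.Nonempty) (hinv : ∀ h, MapsTo (σ h) K K) :
    ∃ M ⊆ K, Minimal (fun M => IsClosed M ∧ M.Nonempty ∧ (∀ h, MapsTo (σ h) M M) ∧ M ⊆ K) M := by
  obtain ⟨M, hM⟩ := zorn_superset
    {M : Set Z | IsClosed M ∧ M.Nonempty ∧ (∀ h, MapsTo (σ h) M M) ∧ M ⊆ K} (by
      intro c hc hchain
      rcases c.eq_empty_or_nonempty with rfl | hcne
      · exact ⟨K, ⟨hKc, hne, hinv, Subset.rfl⟩, by simp⟩
      · have : Nonempty c := hcne.to_subtype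
        refine ⟨⋂₀ c, ⟨isClosed_sInter fun s hs => (hc hs).1, ?_, ?_, ?_⟩,
          fun s hs => sInter_subset_of_mem hs⟩
        · exact IsCompact.nonempty_sInter_of_directed_nonempty_isCompact_isClosed
            (fun s hs t ht => (hchain.total hs ht).elim (fun h => ⟨s, hs, Subset.rfl, h⟩)
              fun h => ⟨t, ht, h, Subset.rfl⟩)
            (fun s hs => (hc hs).2.1)
            (fun s hs => hK.of_isClosed_subset (hc hs).1 (hc hs).2.2.2) fun s hs => (hc hs).1
        · exact fun h z hz s hs => (hc hs).2.2.1 h (hz s hs)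
        · obtain ⟨s, hs⟩ := hcne
          exact (sInter_subset_of_mem hs).trans (hc hs).2.2.2)
  exact ⟨M, hM.prop.2.2.2, hM⟩

/-- The points of a compact minimal set return to each of their neighbourhoods at a relatively
dense set of times. -/
theorem isRelativelyDense_return (hσ : ∀ h, Continuous (σ h))
    (hadd : ∀ h k z, σ h (σ k z) = σ (k + h) z) (hK : IsCompact K)
    (hM : Minimal (fun M => IsClosed M ∧ M.Nonempty ∧ (∀ h, MapsTo (σ h) M M) ∧ M ⊆ K) M)
    {z : Z} (hz : z ∈ M) {W : Set Z} (hW : W ∈ 𝓝 z) : IsRelativelyDense {τ | σ τ z ∈ W} := by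
  have hMc : IsCompact M := hK.of_isClosed_subset hM.prop.1 hM.prop.2.2.2
  obtain ⟨O, hOW, hO, hzO⟩ := mem_nhds_iff.1 hW
  have hcover : M ⊆ ⋃ τ, σ τ ⁻¹' O := by
    intro y hy
    -- by minimality the orbit of `y` is dense in `M`
    have hsub : M ⊆ closure (range fun τ => σ τ y) := by
      have hle : closure (range fun τ => σ τ y) ⊆ M := by
        refine hM.prop.1.closure_subset_iff.2 ?_
        rintro _ ⟨τ, rfl⟩
        exact hM.prop.2.2.1 τ hy
      refine hM.le_of_le ⟨isClosed_closure, (range_nonempty _).closure, fun h => ?_,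
        hle.trans hM.prop.2.2.2⟩ hle
      refine MapsTo.closure ?_ (hσ h)
      rintro _ ⟨τ, rfl⟩
      exact ⟨τ + h, (hadd _ _ _).symm⟩
    obtain ⟨_, hyO, τ, rfl⟩ := mem_closure_iff.1 (hsub hz) O hO hzO
    exact mem_iUnion.2 ⟨τ, hyO⟩
  obtain ⟨t, ht⟩ := hMc.elim_finite_subcover _ (fun τ => hO.preimage (hσ τ)) hcover
  refine ⟨t.sup id + 1, by positivity, fun a => ?_⟩
  obtain ⟨τ, hτ, hmem⟩ := mem_iUnion₂.1 (ht (hM.prop.2.2.1 a hz))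
  refine ⟨a + τ, ?_, le_self_add, ?_⟩
  · have h1 : σ τ (σ a z) ∈ O := hmem
    rw [hadd] at h1
    exact hOW h1
  · have : τ ≤ t.sup id := Finset.le_sup (f := id) hτ
    gcongr
    exact this.trans le_self_add

end Minimal

section Recurrence

variable {X : Type u} [MetricSpace X] {Y : Type u} [MetricSpace Y]

theorem IsAlmostRecurrent.exists_seq {p : C(ℝ≥0, X)} (hp : IsAlmostRecurrent p) :
    ∃ τ : ℕ → ℝ≥0, Tendsto τ atTop atTop ∧
      Tendsto (fun n => timeShift (τ n) p) atTop (𝓝 p) := by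
  obtain ⟨W, hW⟩ := (𝓝 p).exists_antitone_basis
  have hex : ∀ n : ℕ, ∃ τ : ℝ≥0, (n : ℝ≥0) ≤ τ ∧ timeShift τ p ∈ W n := by
    intro n
    obtain ⟨l, _, h⟩ := hp (W n) (hW.mem n)
    obtain ⟨τ, hτ, hn, _⟩ := h n
    exact ⟨τ, hn, hτ⟩
  choose τ hτn hτW using hex
  exact ⟨τ, tendsto_atTop_mono hτn tendsto_natCast_atTop_atTop, hW.tendsto hτW⟩

/-- The hull of a recurrent function is minimal: each of its elements has the function itself in
its hull. -/
theorem IsBirkhoffRecurrent.mem_closure {p p' : C(ℝ≥0, X)} (hp : IsBirkhoffRecurrent p)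
    (hp' : p' ∈ closure (range fun h : ℝ≥0 => timeShift h p)) :
    p ∈ closure (range fun h : ℝ≥0 => timeShift h p') := by
  refine mem_closure_iff_nhds.2 fun W hW => ?_
  obtain ⟨W', hW', hclosed, hsub⟩ := exists_mem_nhds_isClosed_subset hW
  obtain ⟨l, _, hl⟩ := hp.1 W' hW'
  -- the functions with a translate by at most `l` in `W'` form a closed set
  let A : Set (Icc (0 : ℝ≥0) l × C(ℝ≥0, X)) := {z | timeShift z.1.1 z.2 ∈ W'}
  have hjoint : Continuous fun z : Icc (0 : ℝ≥0) l × C(ℝ≥0, X) => timeShift z.1.1 z.2 := by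
    refine ContinuousMap.continuous_of_continuous_uncurry _ ?_
    simp only [Function.uncurry_def, timeShift_apply]
    fun_prop
  have hA : IsClosed (Prod.snd '' A) := isClosedMap_snd_of_compactSpace _ (hclosed.preimage hjoint)
  have hmem : p' ∈ Prod.snd '' A := by
    refine closure_minimal ?_ hA hp'
    rintro _ ⟨a, rfl⟩
    obtain ⟨τ, hτ, haτ, hτl⟩ := hl a
    refine ⟨(⟨τ - a, zero_le, tsub_le_iff_left.2 hτl⟩, timeShift a p), ?_, rfl⟩
    change timeShift (τ - a) (timeShift a p) ∈ W'
    rw [timeShift_timeShift, add_tsub_cancel_of_le haτ]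
    exact hτ
  obtain ⟨⟨⟨τ, _⟩, _⟩, hτ, rfl⟩ := hmem
  exact ⟨_, hsub hτ, τ, rfl⟩

/-- Translates of asymptotically equal functions have the same limits. -/
theorem tendsto_timeShift_of_dist {J p p' : C(ℝ≥0, X)}
    (hd : Tendsto (fun t => dist (J t) (p t)) atTop (𝓝 0)) {τ : ℕ → ℝ≥0}
    (hτ : Tendsto τ atTop atTop) (hp : Tendsto (fun n => timeShift (τ n) p) atTop (𝓝 p')) :
    Tendsto (fun n => timeShift (τ n) J) atTop (𝓝 p') := by
  rw [ContinuousMap.tendsto_iff_forall_isCompact_tendstoUniformlyOn] at hp ⊢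
  intro C hC
  rw [Metric.tendstoUniformlyOn_iff]
  intro ε hε
  obtain ⟨T, hT⟩ := eventually_atTop.1 (hd.eventually (gt_mem_nhds (half_pos hε)))
  filter_upwards [Metric.tendstoUniformlyOn_iff.1 (hp C hC) (ε / 2) (by positivity),
    hτ.eventually (eventually_ge_atTop T)] with n hn hnT t ht
  have h1 := hn t ht
  have h2 := hT (τ n + t) (hnT.trans le_self_add)
  have h3 := dist_triangle_right (p' t) (timeShift (τ n) J t) (timeShift (τ n) p t)
  simp only [timeShift_apply] at *
  linarith

/-- If `J` is asymptotic to a recurrent function `p` and `φ` is Lagrange stable, then along some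
times tending to infinity the translates of `J` converge to `p` and those of `φ` to a recurrent
function. The limit is found in a minimal subset of the `ω`-limit set of `(J, φ)`. -/
theorem IsBirkhoffRecurrent.exists_recurrent_limit {J p : C(ℝ≥0, X)} {φ : C(ℝ≥0, Y)}
    (hp : IsBirkhoffRecurrent p) (hd : Tendsto (fun t => dist (J t) (p t)) atTop (𝓝 0))
    (hφ : IsLagrangeStable φ) :
    ∃ (q : C(ℝ≥0, Y)) (τ : ℕ → ℝ≥0), IsBirkhoffRecurrent q ∧ Tendsto τ atTop atTop ∧
      Tendsto (fun n => timeShift (τ n) J) atTop (𝓝 p) ∧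
      Tendsto (fun n => timeShift (τ n) φ) atTop (𝓝 q) := by
  let u : ℝ≥0 → C(ℝ≥0, X) × C(ℝ≥0, Y) := fun h => (timeShift h J, timeShift h φ)
  let σ : ℝ≥0 → C(ℝ≥0, X) × C(ℝ≥0, Y) → C(ℝ≥0, X) × C(ℝ≥0, Y) := fun h =>
    Prod.map (timeShift h) (timeShift h)
  have hσ : ∀ h, Continuous (σ h) := fun h =>
    (continuous_timeShift h).prodMap (continuous_timeShift h)
  have hadd : ∀ h k z, σ h (σ k z) = σ (k + h) z := fun h k z =>
    Prod.ext (timeShift_timeShift h k z.1) (timeShift_timeShift h k z.2)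
  let H : Set (C(ℝ≥0, X) × C(ℝ≥0, Y)) := closure (range fun h : ℝ≥0 => timeShift h p) ×ˢ
    closure (range fun h : ℝ≥0 => timeShift h φ)
  have hH : IsCompact H := IsCompact.prod hp.2 hφ
  let K : Set (C(ℝ≥0, X) × C(ℝ≥0, Y)) := {z | MapClusterPt z atTop u} ∩ H
  have hKcl : IsClosed K := isClosed_setOfPred_clusterPt.inter (isClosed_closure.prod isClosed_closure)
  have hK : IsCompact K := hH.of_isClosed_subset hKcl inter_subset_right
  have hinvcl : ∀ {W : Type u} [MetricSpace W] (ψ : C(ℝ≥0, W)) (h : ℝ≥0),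
      MapsTo (timeShift h) (closure (range fun h : ℝ≥0 => timeShift h ψ))
        (closure (range fun h : ℝ≥0 => timeShift h ψ)) := by
    intro W _ ψ h
    refine MapsTo.closure ?_ (continuous_timeShift h)
    rintro _ ⟨τ, rfl⟩
    exact ⟨τ + h, (timeShift_timeShift _ _ _).symm⟩
  have hinv : ∀ h, MapsTo (σ h) K K := by
    rintro h z ⟨hz1, hz2⟩
    refine ⟨?_, hinvcl p h hz2.1, hinvcl φ h hz2.2⟩
    have h1 : MapClusterPt (σ h z) atTop (σ h ∘ u) := hz1.continuousAt_comp (hσ h).continuousAt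
    have h2 : σ h ∘ u = u ∘ fun k => k + h := by
      funext k
      exact Prod.ext (timeShift_timeShift h k J) (timeShift_timeShift h k φ)
    rw [h2] at h1
    exact MapClusterPt.of_comp (tendsto_atTop_mono (fun k => le_self_add) tendsto_id) h1
  have hne : K.Nonempty := by
    obtain ⟨τ, hτ, hτp⟩ := hp.1.exists_seq
    obtain ⟨q, hq, θ, hθ, hθq⟩ := IsCompact.tendsto_subseq hφ
      (x := fun n => timeShift (τ n) φ) fun n => subset_closure ⟨τ n, rfl⟩
    refine ⟨(p, q), ?_, subset_closure ⟨0, by ext t; simp⟩, hq⟩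
    have h1 : Tendsto (fun n => u (τ (θ n))) atTop (𝓝 (p, q)) :=
      ((tendsto_timeShift_of_dist hd hτ hτp).comp hθ.tendsto_atTop).prodMk_nhds hθq
    exact MapClusterPt.of_comp (hτ.comp hθ.tendsto_atTop) h1.mapClusterPt
  obtain ⟨M, hMK, hM⟩ := hK.exists_minimal_invariant hKcl hne hinv
  have hMc : IsCompact M := hK.of_isClosed_subset hM.prop.1 hMK
  obtain ⟨⟨p₁, q₁⟩, hpq⟩ := hM.prop.2.1
  have hpM : p ∈ Prod.fst '' M := by
    refine closure_minimal ?_ (hMc.image continuous_fst).isClosed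
      (hp.mem_closure (hMK hpq).2.1)
    rintro _ ⟨h, rfl⟩
    exact ⟨_, hM.prop.2.2.1 h hpq, rfl⟩
  obtain ⟨⟨_, q⟩, hqM, rfl⟩ := hpM
  obtain ⟨τ, hlim, hτ⟩ := MapClusterPt.exists_seq_tendsto (hMK hqM).1
  refine ⟨q, τ, ⟨fun W hW => ?_, hφ.of_mem_closure (hMK hqM).2.2⟩, hτ,
    (continuous_fst.tendsto _).comp hlim, (continuous_snd.tendsto _).comp hlim⟩
  exact isRelativelyDense_return hσ hadd hK hM hqM
    (W := Prod.snd ⁻¹' W) (continuous_snd.continuousAt hW)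

end Recurrence

/-! ### Almost periods and images of recurrent functions -/

section AlmostPeriods

theorem IsRelativelyDense.mono {T : Type v} [AddCommMonoid T] [LinearOrder T] {S S' : Set T}
    (h : IsRelativelyDense S) (hS : S ⊆ S') : IsRelativelyDense S' :=
  h.imp fun _ hl => ⟨hl.1, fun a => (hl.2 a).mono (inter_subset_inter_left _ hS)⟩

variable {T : Type v} [AddCommMonoid T] [TopologicalSpace T]

theorem almostPeriods_mono {X : Type u} [MetricSpace X] {φ : C(T, X)} {ε δ : ℝ} (h : ε ≤ δ) :
    almostPeriods φ ε ⊆ almostPeriods φ δ := fun _ hτ t => (hτ t).trans_le h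

theorem IsBohrAlmostPeriodic.exists_seq [LinearOrder T] {X : Type u} [MetricSpace X] {φ : C(T, X)}
    (h : IsBohrAlmostPeriodic φ) (a : ℕ → T) :
    ∃ τ : ℕ → T, ∀ n : ℕ, a n ≤ τ n ∧ τ n ∈ almostPeriods φ (1 / (n + 1)) := by
  have hex : ∀ n : ℕ, ∃ τ, a n ≤ τ ∧ τ ∈ almostPeriods φ (1 / (n + 1)) := fun n => by
    obtain ⟨l, _, hl⟩ := h (1 / (n + 1)) (by positivity)
    obtain ⟨τ, hτ, ha, _⟩ := hl (a n)
    exact ⟨τ, ha, hτ⟩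
  choose τ hτ using hex
  exact ⟨τ, hτ⟩

variable [ContinuousAdd T]

theorem IsLagrangeStable.comp {X : Type u} {Y : Type w} [MetricSpace X] [MetricSpace Y]
    {φ : C(T, X)} (h : IsLagrangeStable φ) (g : C(X, Y)) : IsLagrangeStable (g.comp φ) := by
  refine (IsCompact.image h (ContinuousMap.continuous_postcomp g)).closure_of_subset ?_
  rintro _ ⟨s, rfl⟩
  exact ⟨timeShift s φ, subset_closure ⟨s, rfl⟩, rfl⟩

theorem IsBirkhoffRecurrent.comp [LinearOrder T] {X : Type u} {Y : Type w} [MetricSpace X] [MetricSpace Y]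
    {φ : C(T, X)} (h : IsBirkhoffRecurrent φ) (g : C(X, Y)) : IsBirkhoffRecurrent (g.comp φ) :=
  ⟨fun _ hV => h.1 _ ((ContinuousMap.continuous_postcomp g).continuousAt hV), h.2.comp g⟩

theorem IsAlmostAutomorphic.comp {X Y : Type u} [MetricSpace X] [MetricSpace Y] {φ : C(ℝ, X)}
    (h : IsAlmostAutomorphic φ) (g : C(X, Y)) : IsAlmostAutomorphic (g.comp φ) := by
  obtain ⟨⟨Z, i, j, ψ, hψ, hV⟩, hL⟩ := h
  exact ⟨⟨Z, i, j, ψ, hψ,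
    fun _ hW => hV _ ((ContinuousMap.continuous_postcomp g).continuousAt hW)⟩, hL.comp g⟩

end AlmostPeriods

/-! ### Asymptotic classes of solutions -/

section Classes

variable {B : Type u} [NormedAddCommGroup B] [NormedSpace ℝ B] [CompleteSpace B]
variable {S V : ℝ → B →L[ℝ] B} {P : B →L[ℝ] B} {N ν : ℝ} {Q : Compacts B} {L : ℝ≥0} {G : ℝ}
variable {J p : C(ℝ≥0, B × C(Q, B))} {φ : C(ℝ≥0, Q)}

theorem IsSolutionFrom.modulus (hD : ExpDichotomy S V P N ν)
    (hφ : IsSolutionFrom S L G 0 (J ∘ Real.toNNReal) (φ ∘ Real.toNNReal)) :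
    ∀ ε > 0, ∃ δ > 0, ∀ s t : ℝ≥0, dist s t < δ → dist (φ s) (φ t) < ε := by
  intro ε hε
  obtain ⟨δ, hδ, h⟩ := hφ.mild.exists_delta hD Q.isCompact (fun t _ => Subtype.coe_prop _)
    hφ.bounded hε
  refine ⟨δ, hδ, fun s t hst => ?_⟩
  simpa [Subtype.dist_eq] using h s t s.2 t.2 (by rwa [← NNReal.dist_eq])

theorem IsSolutionFrom.isLagrangeStable (hD : ExpDichotomy S V P N ν)
    (hφ : IsSolutionFrom S L G 0 (J ∘ Real.toNNReal) (φ ∘ Real.toNNReal)) :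
    IsLagrangeStable φ := by
  have : CompactSpace Q := isCompact_iff_compactSpace.1 Q.isCompact
  exact isLagrangeStable_of_modulus_nnreal isCompact_univ (fun _ => mem_univ _) (hφ.modulus hD)

theorem IsSolutionFrom.isLagrangeStable_real (hD : ExpDichotomy S V P N ν)
    (hφ : IsSolutionFrom S L G 0 (J ∘ Real.toNNReal) (φ ∘ Real.toNNReal)) :
    IsLagrangeStable (φ.comp ⟨Real.toNNReal, continuous_real_toNNReal⟩) := by
  have : CompactSpace Q := isCompact_iff_compactSpace.1 Q.isCompact
  refine isLagrangeStable_of_modulus_real isCompact_univ (fun _ => mem_univ _) fun ε hε => ?_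
  obtain ⟨δ, hδ, h⟩ := hφ.modulus hD ε hε
  refine ⟨δ, hδ, fun s t hst => h _ _ (lt_of_le_of_lt ?_ hst)⟩
  simpa using Real.lipschitzWith_toNNReal.dist_le_mul s t

/-- If the coefficients are asymptotic to a Poisson stable function `p`, the solution is asymptotic
to a function `q` whose `C * ε`-almost periods include the `ε`-almost periods of `p`, up to strictness
of the inequalities. -/
theorem IsSolutionFrom.exists_asymptotic (hD : ExpDichotomy S V P N ν)
    (hLν : (L : ℝ) < ν / (2 * N))
    (hφ : IsSolutionFrom S L G 0 (J ∘ Real.toNNReal) (φ ∘ Real.toNNReal))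
    (hd : Tendsto (fun t => dist (J t) (p t)) atTop (𝓝 0)) {τ : ℕ → ℝ≥0}
    (hτ : Tendsto τ atTop atTop) (hp : ∀ t, Tendsto (fun n => p (t + τ n)) atTop (𝓝 (p t))) :
    ∃ (C : ℝ) (q : C(ℝ≥0, Q)), 0 ≤ C ∧ Tendsto (fun t => dist (φ t) (q t)) atTop (𝓝 0) ∧
      ∀ τ ε, 0 ≤ ε → (∀ t, dist (p (t + τ)) (p t) ≤ ε) →
        ∀ t, dist (q (t + τ)) (q t) ≤ C * ε := by
  obtain ⟨q, -, θ, hθ, hθq⟩ := IsCompact.tendsto_subseq (hφ.isLagrangeStable hD)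
    (x := fun n => timeShift (τ n) φ) fun n => subset_closure ⟨τ n, rfl⟩
  have hσ : Tendsto (τ ∘ θ) atTop atTop := hτ.comp hθ.tendsto_atTop
  have hφq : ∀ t, Tendsto (fun n => φ (t + (τ ∘ θ) n)) atTop (𝓝 (q t)) := by
    intro t
    have hev : Continuous fun ψ : C(ℝ≥0, Q) => ψ t := by fun_prop
    have h1 := (hev.tendsto q).comp hθq
    simpa only [Function.comp_def, timeShift_apply, add_comm t] using h1
  have hJp : ∀ t, Tendsto (fun n => J (t + (τ ∘ θ) n)) atTop (𝓝 (p t)) := by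
    intro t
    have ht : Tendsto (fun n => t + (τ ∘ θ) n) atTop atTop :=
      tendsto_atTop_mono (fun n => le_add_self) hσ
    refine (tendsto_iff_of_dist ?_).2 ((hp t).comp hθ.tendsto_atTop)
    exact hd.comp ht
  obtain ⟨C, hC, H⟩ := hD.exists_dist_le hLν Q
  exact ⟨C, q, hC, hφ.tendsto_dist_of_translates hD hLν hd hJp hφq, H J p φ q _ G hφ hd hσ hφq⟩

theorem IsSolutionFrom.asymptotically_stationary (hD : ExpDichotomy S V P N ν)
    (hLν : (L : ℝ) < ν / (2 * N))
    (hφ : IsSolutionFrom S L G 0 (J ∘ Real.toNNReal) (φ ∘ Real.toNNReal))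
    (hJ : IsAsymptotically IsTimeStationary J) : IsAsymptotically IsTimeStationary φ := by
  obtain ⟨p, hp, hd⟩ := hJ
  obtain ⟨C, q, hC, hq, hE⟩ := hφ.exists_asymptotic hD hLν hd (τ := fun n => (n : ℝ≥0))
    tendsto_natCast_atTop_atTop fun t => by
      simp only [hp (t + _)]
      rw [← hp t]
      exact tendsto_const_nhds
  refine ⟨q, fun t => ?_, hq⟩
  have h1 := hE t 0 le_rfl (fun s => by rw [hp (s + t), hp s, dist_self]) 0
  rw [mul_zero, zero_add] at h1
  exact dist_le_zero.1 h1

theorem IsSolutionFrom.asymptotically_periodic (hD : ExpDichotomy S V P N ν)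
    (hLν : (L : ℝ) < ν / (2 * N))
    (hφ : IsSolutionFrom S L G 0 (J ∘ Real.toNNReal) (φ ∘ Real.toNNReal)) {τ : ℝ≥0}
    (hJ : IsAsymptotically (IsTimePeriodic τ) J) : IsAsymptotically (IsTimePeriodic τ) φ := by
  rcases eq_zero_or_pos τ with rfl | hτ
  · -- every function is `0`-periodic
    exact ⟨φ, fun t => by rw [add_zero], by simp⟩
  obtain ⟨p, hp, hd⟩ := hJ
  have hper : ∀ (n : ℕ) t, p (t + n * τ) = p t := by
    intro n
    induction n with
    | zero => intro t; simp
    | succ n ih => intro t; rw [Nat.cast_succ, add_one_mul, ← add_assoc, hp, ih]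
  obtain ⟨C, q, hC, hq, hE⟩ := hφ.exists_asymptotic hD hLν hd (τ := fun n => (n : ℝ≥0) * τ)
    (tendsto_natCast_atTop_atTop.atTop_mul_const hτ) fun t => by
      simp only [hper]
      exact tendsto_const_nhds
  refine ⟨q, fun t => ?_, hq⟩
  have h1 := hE τ 0 le_rfl (fun s => by rw [hp s, dist_self]) t
  rw [mul_zero] at h1
  exact dist_le_zero.1 h1

theorem IsSolutionFrom.asymptotically_bohr (hD : ExpDichotomy S V P N ν)
    (hLν : (L : ℝ) < ν / (2 * N))
    (hφ : IsSolutionFrom S L G 0 (J ∘ Real.toNNReal) (φ ∘ Real.toNNReal))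
    (hJ : IsAsymptotically IsBohrAlmostPeriodic J) : IsAsymptotically IsBohrAlmostPeriodic φ := by
  obtain ⟨p, hp, hd⟩ := hJ
  obtain ⟨τ, hτ⟩ := hp.exists_seq fun n => (n : ℝ≥0)
  obtain ⟨C, q, hC, hq, hE⟩ := hφ.exists_asymptotic hD hLν hd
    (tendsto_atTop_mono (fun n => (hτ n).1) tendsto_natCast_atTop_atTop) fun t => by
      rw [tendsto_iff_dist_tendsto_zero]
      exact squeeze_zero (fun _ => dist_nonneg) (fun n => ((hτ n).2 t).le)
        tendsto_one_div_add_atTop_nhds_zero_nat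
  refine ⟨q, fun ε hε => ?_, hq⟩
  have hδ : 0 < ε / (C + 1) := by positivity
  refine (hp _ hδ).mono fun τ hτ t => ?_
  refine (hE τ _ hδ.le (fun s => (hτ s).le) t).trans_lt ?_
  rw [mul_div_assoc', div_lt_iff₀ (by positivity)]
  nlinarith

theorem IsSolutionFrom.asymptotically_quasiPeriodic (hD : ExpDichotomy S V P N ν)
    (hLν : (L : ℝ) < ν / (2 * N))
    (hφ : IsSolutionFrom S L G 0 (J ∘ Real.toNNReal) (φ ∘ Real.toNNReal)) {k : ℕ}
    {freq : Fin k → ℝ} (hJ : IsAsymptotically (IsQuasiPeriodic freq) J) :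
    IsAsymptotically (IsQuasiPeriodic freq) φ := by
  have : CompactSpace Q := isCompact_iff_compactSpace.1 Q.isCompact
  obtain ⟨p, ⟨hfreq, Φ, hper, hpΦ⟩, hd⟩ := hJ
  obtain ⟨Ψ, hΨ⟩ := exists_torus_factor hper
  have hpΨ : ∀ t : ℝ≥0, p t = Ψ (torusFlow freq t) := fun t => by
    rw [hpΦ, ← hΨ]; rfl
  -- return times of the flow to the origin of the torus
  have hex : ∀ n : ℕ, ∃ t : ℝ≥0, (n : ℝ≥0) ≤ t ∧ dist (torusFlow freq t) 0 < 1 / (n + 1) := by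
    intro n
    obtain ⟨t, ht, hdt⟩ := exists_dist_torusFlow_lt hfreq 0
      (ε := 1 / ((n : ℝ) + 1)) (by positivity) n
    have ht0 : 0 ≤ t := n.cast_nonneg.trans ht
    exact ⟨⟨t, ht0⟩, by exact_mod_cast ht, hdt⟩
  choose τ hτn hτ using hex
  have hτ0 : Tendsto (fun n => torusFlow freq (τ n)) atTop (𝓝 0) := by
    rw [tendsto_iff_dist_tendsto_zero]
    exact squeeze_zero (fun _ => dist_nonneg) (fun n => (hτ n).le)
      tendsto_one_div_add_atTop_nhds_zero_nat
  obtain ⟨C, q, hC, hq, hE⟩ := hφ.exists_asymptotic hD hLν hd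
    (tendsto_atTop_mono hτn tendsto_natCast_atTop_atTop) fun t => by
      simp only [hpΨ, NNReal.coe_add, torusFlow_add]
      have h1 := hτ0.const_add (torusFlow freq t)
      rw [add_zero] at h1
      exact (Ψ.continuous.tendsto _).comp h1
  have hu := Metric.uniformContinuous_iff.1
    (CompactSpace.uniformContinuous_of_continuous Ψ.continuous)
  have key : ∀ ε > 0, ∃ δ > 0, ∀ s t : ℝ≥0, s ≤ t →
      dist (torusFlow freq s) (torusFlow freq t) < δ → dist (q s) (q t) < ε := by
    intro ε hε
    have hη : 0 < ε / (C + 1) := by positivity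
    obtain ⟨δ, hδ, h⟩ := hu _ hη
    refine ⟨δ, hδ, fun s t hst hst' => ?_⟩
    have h1 := hE (t - s) _ hη.le (fun r => by
      rw [hpΨ, hpΨ, NNReal.coe_add, torusFlow_add]
      refine (h ?_).le
      have h2 : torusFlow freq t = torusFlow freq s + torusFlow freq (t - s : ℝ≥0) := by
        rw [← torusFlow_add, ← NNReal.coe_add, add_tsub_cancel_of_le hst]
      rw [h2, dist_self_add_right] at hst'
      rwa [dist_self_add_left]) s
    rw [add_tsub_cancel_of_le hst, dist_comm] at h1
    refine h1.trans_lt ?_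
    rw [mul_div_assoc', div_lt_iff₀ (by positivity)]
    nlinarith
  obtain ⟨Ξ, hΞ⟩ := exists_torus_extension hfreq (q := q) fun ε hε => by
    obtain ⟨δ, hδ, h⟩ := key ε hε
    refine ⟨δ, hδ, fun s t hst => ?_⟩
    rcases le_total s t with hle | hle
    · exact h s t hle hst
    · rw [dist_comm]; exact h t s hle (by rwa [dist_comm])
  refine ⟨q, ⟨hfreq, ⟨fun θ => Ξ fun i => ((θ i / (2 * Real.pi) : ℝ) : UnitAddCircle), ?_⟩,
    fun θ i => ?_, fun t => (hΞ t).symm⟩, hq⟩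
  · exact Ξ.continuous.comp (continuous_pi fun i =>
      (AddCircle.continuous_mk' 1).comp (by fun_prop))
  · simp only [ContinuousMap.coe_mk]
    congr 1
    funext j
    rcases eq_or_ne j i with rfl | hij
    · have hpi : (2 * Real.pi) ≠ 0 := by positivity
      rw [Function.update_self, add_div, div_self hpi, AddCircle.coe_add, AddCircle.coe_period,
        add_zero]
    · rw [Function.update_of_ne hij]

theorem IsSolutionFrom.asymptotically_birkhoff (hD : ExpDichotomy S V P N ν)
    (hLν : (L : ℝ) < ν / (2 * N))
    (hφ : IsSolutionFrom S L G 0 (J ∘ Real.toNNReal) (φ ∘ Real.toNNReal))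
    (hJ : IsAsymptotically IsBirkhoffRecurrent J) : IsAsymptotically IsBirkhoffRecurrent φ := by
  obtain ⟨p, hp, hd⟩ := hJ
  obtain ⟨q, τ, hq, hτ, hJp, hφq⟩ := hp.exists_recurrent_limit hd (hφ.isLagrangeStable hD)
  refine ⟨q, hq, hφ.tendsto_dist_of_translates hD hLν hd (σ := τ) (fun t => ?_) fun t => ?_⟩
  · have hev : Continuous fun ψ : C(ℝ≥0, B × C(Q, B)) => ψ t := by fun_prop
    simpa only [Function.comp_def, timeShift_apply, add_comm t] using (hev.tendsto p).comp hJp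
  · have hev : Continuous fun ψ : C(ℝ≥0, Q) => ψ t := by fun_prop
    simpa only [Function.comp_def, timeShift_apply, add_comm t] using (hev.tendsto q).comp hφq

/-- In the almost automorphic case the limit function solves the limit equation on the whole line.
Since that solution is unique, times that nearly shift the coefficients to themselves nearly shift
the solution to itself, and the same Bohr almost periodic function serves for both. -/
theorem IsSolutionFrom.asymptotically_almostAutomorphic (hD : ExpDichotomy S V P N ν)
    (hLν : (L : ℝ) < ν / (2 * N))
    (hφ : IsSolutionFrom S L G 0 (J ∘ Real.toNNReal) (φ ∘ Real.toNNReal))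
    (hJ : IsAsymptoticallyAlmostAutomorphic J) : IsAsymptoticallyAlmostAutomorphic φ := by
  obtain ⟨p, ⟨⟨Z, iZ, jZ, ψ, hψ, hLev⟩, hpL⟩, hd⟩ := hJ
  have hshift : ∀ s : ℕ → ℝ, (∀ n : ℕ, s n ∈ almostPeriods ψ (1 / (n + 1))) →
      ∀ t, Tendsto (fun n => p (t + s n)) atTop (𝓝 (p t)) := by
    intro s hs t
    have h1 : Tendsto (fun n => timeShift (s n) p) atTop (𝓝 p) := by
      intro W hW
      obtain ⟨δ, hδ, h⟩ := hLev W hW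
      have h2 := tendsto_one_div_add_atTop_nhds_zero_nat (𝕜 := ℝ).eventually (gt_mem_nhds hδ)
      exact h2.mono fun n hn => h _ (almostPeriods_mono hn.le (hs n))
    have hev : Continuous fun ψ : C(ℝ, B × C(Q, B)) => ψ t := by fun_prop
    simpa only [Function.comp_def, timeShift_apply, add_comm t] using (hev.tendsto p).comp h1
  have hev : ∀ t, Continuous fun ψ : C(ℝ, Q) => ψ t := fun t => by fun_prop
  obtain ⟨τ, hτ⟩ := hψ.exists_seq fun n => (n : ℝ)
  have hτ' : Tendsto τ atTop atTop :=
    tendsto_atTop_mono (fun n => (hτ n).1) tendsto_natCast_atTop_atTop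
  set φ' : C(ℝ, Q) := φ.comp ⟨Real.toNNReal, continuous_real_toNNReal⟩ with hφ'
  have hφL : IsLagrangeStable φ' := hφ.isLagrangeStable_real hD
  obtain ⟨q, hqmem, θ, hθ, hθq⟩ := IsCompact.tendsto_subseq hφL
    (x := fun n => timeShift (τ n) φ') fun n => subset_closure ⟨τ n, rfl⟩
  have hσ : Tendsto (τ ∘ θ) atTop atTop := hτ'.comp hθ.tendsto_atTop
  have hd' : Tendsto (fun t : ℝ => dist (J t.toNNReal) (p t)) atTop (𝓝 0) := by
    refine (hd.comp Real.tendsto_toNNReal_atTop).congr' ?_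
    filter_upwards [eventually_ge_atTop 0] with t ht
    simp [ht]
  have hsol : ∀ a, IsSolutionFrom S L G a p q := by
    intro a
    refine IsSolutionFrom.of_tendsto hD (fun n => hφ.translate ((τ ∘ θ) n)) ?_ p.continuous
      q.continuous (fun t _ => ?_) fun t _ => ?_
    · filter_upwards [hσ.eventually (eventually_ge_atTop (-a))] with n hn
      linarith
    · refine (tendsto_iff_of_dist ?_).2 ((hshift τ (fun n => (hτ n).2) t).comp hθ.tendsto_atTop)
      exact hd'.comp (tendsto_atTop_add_const_left atTop t hσ)
    · change Tendsto (fun n => φ' (t + τ (θ n))) atTop (𝓝 (q t))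
      have h1 := ((hev t).tendsto q).comp hθq
      simpa only [Function.comp_def, timeShift_apply, add_comm t] using h1
  have hqL : IsLagrangeStable q := hφL.of_mem_closure hqmem
  refine ⟨q, ⟨⟨Z, iZ, jZ, ψ, hψ, fun W hW => ?_⟩, hqL⟩, ?_⟩
  · by_contra! hcon
    choose s hs hsW using fun n : ℕ => hcon (1 / ((n : ℝ) + 1)) (by positivity)
    obtain ⟨q', -, η, hη, hηq⟩ := IsCompact.tendsto_subseq hqL
      (x := fun n => timeShift (s n) q) fun n => subset_closure ⟨s n, rfl⟩
    have hsol' : ∀ a, IsSolutionFrom S L G a p q' := by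
      intro a
      refine IsSolutionFrom.of_tendsto hD (b := fun _ => a)
        (fun n => by simpa using (hsol (a + s (η n))).translate (s (η n)))
        (Eventually.of_forall fun _ => le_rfl) p.continuous q'.continuous (fun t _ => ?_)
        fun t _ => ?_
      · exact (hshift s hs t).comp hη.tendsto_atTop
      · have h1 := ((hev t).tendsto q').comp hηq
        simpa only [Function.comp_def, timeShift_apply, add_comm t] using h1
    have heq : q' = q := DFunLike.coe_injective (IsSolutionFrom.eq_of_entire hD hLν hsol' hsol)
    rw [heq] at hηq
    obtain ⟨n, hn⟩ := (hηq.eventually hW).exists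
    exact hsW _ hn
  · have h1 := (hφ.tendsto_dist hD hLν (hsol 0) hd').comp (NNReal.tendsto_coe_atTop.2 tendsto_id)
    simpa [Function.comp_def] using h1

end Classes

/-! ### The semilinear equation on the half-line -/

section Assembly

variable {𝕜 : Type v} {B : Type u} [RCLike 𝕜] [NormedAddCommGroup B] [NormedSpace 𝕜 B]
  [NormedSpace ℝ B]

/-- The two formulations of mild solutions agree. -/
theorem isMildSolution_iff [CompleteSpace B] {U : ℝ≥0 → B →L[𝕜] B} {V : ℝ → B →L[ℝ] B}
    {P : B →L[ℝ] B} {N ν : ℝ}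
    (hD : ExpDichotomy (fun t => (U t.toNNReal).toRealOperator) V P N ν)
    {f : C(ℝ≥0, B)} {F : C(ℝ≥0 × B, B)} {φ : C(ℝ≥0, B)} :
    IsMildSolution U f F φ ↔ IsMildFrom (fun t => (U t.toNNReal).toRealOperator) 0
      (fun t => φ t.toNNReal) (semilinearForcing f F φ) := by
  have hint : ∀ t : ℝ, 0 ≤ t → ∫ s in (0 : ℝ)..t, (U (t - s).toNNReal).toRealOperator
      (semilinearForcing f F φ s) = ∫ s in (0 : ℝ)..t,
        U (t.toNNReal - s.toNNReal) (f s.toNNReal + F (s.toNNReal, φ s.toNNReal)) := by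
    intro t ht
    refine intervalIntegral.integral_congr fun s hs => ?_
    rw [Set.uIcc_of_le ht] at hs
    simp only [semilinearForcing, ContinuousLinearMap.toRealOperator_apply]
    rw [NNReal.sub_def, Real.coe_toNNReal _ ht, Real.coe_toNNReal _ hs.1]
  constructor
  · intro h
    refine IsMildFrom.of_initial hD (continuous_semilinearForcing f F φ.continuous) fun t ht => ?_
    have h1 := h t.toNNReal
    rw [Real.coe_toNNReal _ ht, ← hint t ht] at h1
    simpa using h1
  · intro h t
    have h1 := h 0 le_rfl t t.2
    simp only [zero_add] at h1
    rw [hint t t.2] at h1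
    simpa using h1

theorem IsAsymptotically.comp {X Y : Type*} [MetricSpace X] [MetricSpace Y]
    {K : C(ℝ≥0, X) → Prop} {K' : C(ℝ≥0, Y) → Prop} {φ : C(ℝ≥0, X)} (h : IsAsymptotically K φ)
    {g : C(X, Y)} (hg : Isometry g) (hK : ∀ q, K q → K' (g.comp q)) :
    IsAsymptotically K' (g.comp φ) := by
  obtain ⟨q, hq, hd⟩ := h
  exact ⟨g.comp q, hK q hq, by simpa [hg.dist_eq] using hd⟩

/-- A Lagrange stable mild solution, with the closure of its range as the compact set `Q`, solves
the equation with coefficients `(f, F_Q)`. -/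
theorem IsMildFrom.isSolutionFrom {S : ℝ → B →L[ℝ] B} {f : C(ℝ≥0, B)} {F : C(ℝ≥0 × B, B)}
    (hf : IsLagrangeStable f) (hF : IsLagrangeStableParam F) {L : ℝ≥0}
    (hL : ∀ t : ℝ≥0, LipschitzWith L fun x : B => F (t, x)) {φ : C(ℝ≥0, B)} {Q : Compacts B}
    (hφQ : ∀ t, φ t ∈ Q)
    (h : IsMildFrom S 0 (fun t => φ t.toNNReal) (semilinearForcing f F φ)) :
    ∃ G, IsSolutionFrom S L G 0 (jointCoefficients f F Q ∘ Real.toNNReal)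
      ((fun t => (⟨φ t, hφQ t⟩ : Q)) ∘ Real.toNNReal) := by
  obtain ⟨C, hC, hmem⟩ := exists_compact_semilinearForcing hf hF Q.isCompact
  obtain ⟨G, hG⟩ := hC.isBounded.exists_norm_le
  refine ⟨G, (jointCoefficients f F Q).continuous.comp continuous_real_toNNReal, ?_,
    fun t _ => ?_, fun t _ => hG _ (hmem φ hφQ t), h⟩
  · exact (φ.continuous.subtype_mk hφQ).comp continuous_real_toNNReal
  · exact LipschitzWith.of_dist_le_mul fun y z => (hL t.toNNReal).dist_le_mul y z

end Assembly

theorem mainTheorem8 {𝕜 : Type v} {B : Type u} [RCLike 𝕜] [NormedAddCommGroup B]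
    [NormedSpace 𝕜 B] [NormedSpace ℝ B] [CompleteSpace B]
    (A : B →ₗ.[𝕜] B) (U : ℝ≥0 → B →L[𝕜] B) (hU : IsC0Semigroup U)
    (hA : IsInfinitesimalGenerator A U)
    (P : B →L[𝕜] B) (N ν : ℝ) (hhyp : IsHyperbolicSemigroup U P N ν)
    (f : C(ℝ≥0, B)) (F : C(ℝ≥0 × B, B))
    (hf : IsLagrangeStable f) (hF : IsLagrangeStableParam F)
    (L : ℝ≥0) (hL : ∀ t : ℝ≥0, LipschitzWith L fun x : B => F (t, x))
    (hLν : (L : ℝ) < ν / (2 * N)) :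
    (∃! φ : C(ℝ≥0, B), IsLagrangeStable φ ∧ IsMildSolution U f F φ ∧ P (φ 0) = 0) ∧
    ∀ (φ : C(ℝ≥0, B)) (hφ : IsLagrangeStable φ), IsMildSolution U f F φ → P (φ 0) = 0 →
      (IsAsymptotically IsTimeStationary (jointCoefficients f F hφ.rangeClosure) →
        IsAsymptotically IsTimeStationary φ) ∧
      (∀ τ : ℝ≥0,
        IsAsymptotically (IsTimePeriodic τ) (jointCoefficients f F hφ.rangeClosure) →
          IsAsymptotically (IsTimePeriodic τ) φ) ∧
      (∀ (k : ℕ) (freq : Fin k → ℝ),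
        IsAsymptotically (IsQuasiPeriodic freq) (jointCoefficients f F hφ.rangeClosure) →
          IsAsymptotically (IsQuasiPeriodic freq) φ) ∧
      (IsAsymptotically IsBohrAlmostPeriodic (jointCoefficients f F hφ.rangeClosure) →
        IsAsymptotically IsBohrAlmostPeriodic φ) ∧
      (IsAsymptoticallyAlmostAutomorphic (jointCoefficients f F hφ.rangeClosure) →
        IsAsymptoticallyAlmostAutomorphic φ) ∧
      (IsAsymptotically IsBirkhoffRecurrent (jointCoefficients f F hφ.rangeClosure) →
        IsAsymptotically IsBirkhoffRecurrent φ) := by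
  obtain ⟨V, hD⟩ := hhyp.exists_expDichotomy hU
  refine ⟨?_, fun φ hφ hmild _ => ?_⟩
  · obtain ⟨φ, hφL, hφ, hφ0⟩ := hD.exists_semilinear hf hF hL hLν
    refine ⟨φ, ⟨hφL, (isMildSolution_iff hD).2 hφ, hφ0⟩, ?_⟩
    rintro ψ ⟨hψL, hψ, hψ0⟩
    obtain ⟨M₁, hM₁⟩ := hφL.isCompact_closure_range.isBounded.exists_norm_le
    obtain ⟨M₂, hM₂⟩ := hψL.isCompact_closure_range.isBounded.exists_norm_le
    exact IsMildFrom.eq_of_proj_eq_zero hD hL hLν (M := max M₁ M₂)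
      (fun t => (hM₂ _ (subset_closure (mem_range_self t))).trans (le_max_right _ _))
      (fun t => (hM₁ _ (subset_closure (mem_range_self t))).trans (le_max_left _ _))
      ((isMildSolution_iff hD).1 hψ) hφ hψ0 hφ0
  · have hφQ : ∀ t, φ t ∈ hφ.rangeClosure := fun t => subset_closure (mem_range_self t)
    obtain ⟨G, hsol⟩ := IsMildFrom.isSolutionFrom hf hF hL hφQ ((isMildSolution_iff hD).1 hmild)
    let φ' : C(ℝ≥0, hφ.rangeClosure) := ⟨fun t => ⟨φ t, hφQ t⟩, φ.continuous.subtype_mk hφQ⟩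
    let g : C(hφ.rangeClosure, B) := ⟨Subtype.val, continuous_subtype_val⟩
    have hg : Isometry g := isometry_subtype_coe
    have htransfer : ∀ {K : C(ℝ≥0, hφ.rangeClosure) → Prop} {K' : C(ℝ≥0, B) → Prop},
        IsAsymptotically K φ' → (∀ q, K q → K' (g.comp q)) → IsAsymptotically K' φ :=
      fun h hK => IsAsymptotically.comp (φ := φ') (g := g) h hg hK
    have hsol' : IsSolutionFrom _ L G 0 (jointCoefficients f F hφ.rangeClosure ∘ Real.toNNReal)
      (φ' ∘ Real.toNNReal) := hsol
    refine ⟨fun h => ?_, fun τ h => ?_, fun k freq h => ?_, fun h => ?_, fun h => ?_, fun h => ?_⟩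
    · exact htransfer (hsol'.asymptotically_stationary hD hLν h) fun q hq t => congrArg g (hq t)
    · exact htransfer (hsol'.asymptotically_periodic hD hLν h) fun q hq t => congrArg g (hq t)
    · refine htransfer (hsol'.asymptotically_quasiPeriodic hD hLν h) ?_
      rintro q ⟨hfreq, Φ, hper, hq⟩
      exact ⟨hfreq, g.comp Φ, fun θ i => congrArg g (hper θ i), fun t => congrArg g (hq t)⟩
    · refine htransfer (hsol'.asymptotically_bohr hD hLν h) fun q hq ε hε => (hq ε hε).mono ?_
      exact fun τ hτ t => (hg.dist_eq _ _).trans_lt (hτ t)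
    · obtain ⟨q, hq, hd⟩ := hsol'.asymptotically_almostAutomorphic hD hLν h
      exact ⟨g.comp q, hq.comp g, hd⟩
    · exact htransfer (hsol'.asymptotically_birkhoff hD hLν h) fun q hq => hq.comp g
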